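/- Let $\Gamma$ be the $2\pi$-periodic necklace graph: for $n\in\mathbb Z$ it has the link $\Gamma_{n,0}\cong[2\pi n,2\pi n+\pi]$ and the two semicircles $\Gamma_{n,\pm}\cong[2\pi n+\pi,2\pi(n+1)]$, glued at the points $2\pi n+\pi$ and $2\pi(n+1)$. Write $u=(u_0,u_+,u_-)$ for functions on $\Gamma$. Let $L^2(\Gamma)_{\rm symm}$ be the space of complex $L^2$-functions with $u_+=u_-$, and let $H^1_c(\Gamma)_{\rm symm}$ be the space of those $u\in L^2(\Gamma)_{\rm symm}$ that are $H^1$ on the edges with $u'\in L^2(\Gamma)$ and are continuous at the vertices. Let $\Delta$ be the edgewise second derivative on all $u\in H^1_c(\Gamma)\cap H^2(\Gamma)$ satisfying Kirchhoff's conditions $u_0'=u_+'+u_-'$ at all vertices. Let $T>0$, $\omega=2\pi/T$, $\alpha\ge 0$, let $\kappa$ be an odd integer and $\kappa\mathbb Z_{odd}=\{\kappa m: m \text{ odd}\}$. For $k\in\kappa\mathbb Z_{odd}$ let $L_k=-\frac{d^2}{dx^2}-\omega^2k^2+\alpha$ be the self-adjoint operator in $L^2(\Gamma)_{\rm symm}$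 with domain $\mathcal D(\Delta)\cap L^2(\Gamma)_{\rm symm}$, and let $b_{|L_k|}(v,v)=\||L_k|^{1/2}v\|_{L^2(\Gamma)}^2$. Let $\mathcal H$ and $H$ be the spaces of all $$u(x,t)=\sum_{k\in\kappa\mathbb Z_{odd}}u_k(x)e^{i\omega kt},\qquad u_k\in H^1_c(\Gamma)_{\rm symm},\quad \overline{u_k}=u_{-k},$$ with finite norm $$\|u\|_{\mathcal H}^2=\sum_{k\in\kappa\mathbb Z_{odd}}b_{|L_k|}(u_k,u_k),\qquad\text{respectively}\qquad \|u\|_H^2=\sum_{k\in\kappa\mathbb Z_{odd}}\Bigl(\frac1{|k|}\|u_k'\|_{L^2(\Gamma)}^2+|k|\,\|u_k\|_{L^2(\Gamma)}^2\Bigr).$$ (1) Suppose that $0\notin\overline{\bigcup_{k\in\kappa\mathbb Z_{odd}}\sigma(L_k)}$, and that $\omega=k_0/2$ for an odd $k_0\in\mathbb N$ or, more generally, that for some $K$ with $\omega^2k^2\ge\alpha$ for all $k\in\kappa\mathbb Z_{odd}$, $|k|>K$, $$\inf\Bigl\{\bigl|\sqrt{\lambda_m(l)}-\sqrt{\omega^2k^2-\alpha}\bigr|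 : l\in(-\tfrac12,\tfrac12],\ m\in\mathbb Z,\ k\in\kappa\mathbb Z_{odd},\ |k|>K\Bigr\}>0,$$ where $\lambda_m(l)=\bigl(\frac1{2\pi}\arccos(\frac19(8\cos(2\pi l)+1))+m\bigr)^2$ are the quasiperiodic eigenvalues of $-\Delta$. Then $\mathcal H$ embeds continuously into $H$: there is $C$ with $u\in H$ and $\|u\|_H\le C\|u\|_{\mathcal H}$ for all $u\in\mathcal H$. (2) For every $q\in[2,4)$ the space $H$ embeds continuously into $L^q(\Gamma\times\mathbb T_T)$, where $\mathbb T_T=\mathbb R/T\mathbb Z$: for every $u\in H$ the series converges in $L^2(\Gamma\times\mathbb T_T)$, its sum determines the coefficients $u_k$, and there is $C$ such that the sum belongs to $L^q(\Gamma\times\mathbb T_T)$ with $\|u\|_{L^q(\Gamma\times\mathbb T_T)}\le C\|u\|_H$ for all $u\in H$. -/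

import Mathlib

open MeasureTheory
open scoped ENNReal NNReal

noncomputable section

namespace Necklace

/-! ## The periodic necklace graph -/

/-- Measurable structure on the set of labels `0, +, -` of the edges of one period cell:
every set is measurable. -/
instance : MeasurableSpace SignType := ⊤

instance : DiscreteMeasurableSpace SignType := ⟨fun _ => trivial⟩

/-- The ambient space of the metric graph: `(n, j, x)` is the point with coordinate `x` on the edge
with label `j` in the period cell `n`, where `j = 0` is the horizontal link and `j = 1`, `j = -1`
are the upper and the lower semicircle.  Only the points with `x ∈ edge n j` belong to the graph. -/
abbrev Pt : Type := ℤ × SignType × ℝ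

/-- Left end of the interval with which the edge `(n, j)` is identified. -/
def edgeStart (n : ℤ) (j : SignType) : ℝ :=
  if j = 0 then 2 * Real.pi * n else 2 * Real.pi * n + Real.pi

/-- The interval of length `π` with which the edge `(n, j)` is identified, that is
`[2πn, 2πn + π]` for the link and `[2πn + π, 2π(n + 1)]` for the two semicircles. -/
def edge (n : ℤ) (j : SignType) : Set ℝ :=
  Set.Icc (edgeStart n j) (edgeStart n j + Real.pi)

/-- The points of the (closed, not yet glued) edges. -/
def graphSet : Set Pt := {p | p.2.2 ∈ edge p.1 p.2.1}

/-- Lebesgue measure on the necklace graph: the sum of the Lebesgue measures on its edges. -/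
def graphMeasure : Measure Pt :=
  ((Measure.count : Measure ℤ).prod
    ((Measure.count : Measure SignType).prod (volume : Measure ℝ))).restrict graphSet

/-- Reflection of the graph, which exchanges the upper and the lower semicircles. -/
def reflect (p : Pt) : Pt := (p.1, -p.2.1, p.2.2)

theorem measurePreserving_neg_signType :
    MeasurePreserving (fun j : SignType => -j) Measure.count Measure.count := by
  refine ⟨measurable_from_top, ?_⟩
  ext s hs
  rw [Measure.map_apply measurable_from_top hs]
  have h : (fun j : SignType => -j) ⁻¹' s = (fun j : SignType => -j) '' s := by
    ext j
    simp only [Set.mem_preimage, Set.mem_image]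
    constructor
    · intro hj
      exact ⟨-j, hj, neg_neg j⟩
    · rintro ⟨i, hi, rfl⟩
      simpa using hi
  rw [h, Measure.count_injective_image neg_injective]

theorem measurePreserving_reflect : MeasurePreserving reflect graphMeasure graphMeasure := by
  have h0 : MeasurePreserving reflect
      ((Measure.count : Measure ℤ).prod
        ((Measure.count : Measure SignType).prod (volume : Measure ℝ)))
      ((Measure.count : Measure ℤ).prod
        ((Measure.count : Measure SignType).prod (volume : Measure ℝ))) :=
    (MeasurePreserving.id _).prod (measurePreserving_neg_signType.prod (MeasurePreserving.id _))
  have hpre : reflect ⁻¹' graphSet = graphSet := by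
    ext p
    simp [reflect, graphSet, edge, edgeStart]
  have hmeas : MeasurableSet graphSet := by
    have hstart : Measurable fun p : Pt => edgeStart p.1 p.2.1 := by
      have h1 : Measurable fun q : ℤ × SignType => edgeStart q.1 q.2 := measurable_of_countable _
      exact h1.comp (measurable_fst.prodMk (measurable_fst.comp measurable_snd))
    have hx : Measurable fun p : Pt => p.2.2 := measurable_snd.comp measurable_snd
    exact (measurableSet_le hstart hx).inter (measurableSet_le hx (hstart.add_const Real.pi))
  have h := h0.restrict_preimage hmeas
  rwa [hpre] at h

/-! ## Function spaces on the graph -/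

/-- `L²(Γ)`. -/
abbrev L2 : Type := Lp ℂ 2 graphMeasure

/-- `L²(Γ)_symm`, the closed subspace of all `u ∈ L²(Γ)` with `u ∘ reflect = u`, i.e. `u₊ = u₋`. -/
abbrev L2symm : Submodule ℂ L2 :=
  LinearMap.eqLocus
    (Lp.compMeasurePreservingₗᵢ ℂ reflect measurePreserving_reflect).toLinearMap
    (LinearMap.id : L2 →ₗ[ℂ] L2)

instance : CompleteSpace L2symm := by
  have h : IsClosed (L2symm : Set L2) :=
    isClosed_eq (Lp.compMeasurePreservingₗᵢ ℂ reflect measurePreserving_reflect).continuous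
      continuous_id
  exact h.completeSpace_coe

/-- On every closed edge, `f` is absolutely continuous with derivative `v`. -/
def EdgewisePrimitive (f v : Pt → ℂ) : Prop :=
  ∀ n j, ∀ x ∈ edge n j,
    f (n, j, x) = f (n, j, edgeStart n j) + ∫ y in (edgeStart n j)..x, v (n, j, y)

/-- Continuity at the vertices. -/
def VertexContinuous (f : Pt → ℂ) : Prop :=
  ∀ n : ℤ,
    (f (n, 0, 2 * Real.pi * n + Real.pi) = f (n, 1, 2 * Real.pi * n + Real.pi) ∧
      f (n, 0, 2 * Real.pi * n + Real.pi) = f (n, -1, 2 * Real.pi * n + Real.pi)) ∧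
    (f (n + 1, 0, 2 * Real.pi * (n + 1)) = f (n, 1, 2 * Real.pi * (n + 1)) ∧
      f (n + 1, 0, 2 * Real.pi * (n + 1)) = f (n, -1, 2 * Real.pi * (n + 1)))

/-- Kirchhoff's flux condition at the vertices for the derivative `g` of a function. -/
def VertexFlux (g : Pt → ℂ) : Prop :=
  ∀ n : ℤ,
    g (n, 0, 2 * Real.pi * n + Real.pi) =
      g (n, 1, 2 * Real.pi * n + Real.pi) + g (n, -1, 2 * Real.pi * n + Real.pi) ∧
    g (n + 1, 0, 2 * Real.pi * (n + 1)) =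
      g (n, 1, 2 * Real.pi * (n + 1)) + g (n, -1, 2 * Real.pi * (n + 1))

/-- `u ∈ H¹_c(Γ)` with edgewise weak derivative `v ∈ L²(Γ)`: `u` has a representative that is
absolutely continuous on every edge with derivative `v` and continuous at the vertices. -/
def IsH1cDeriv (u v : L2) : Prop :=
  ∃ f : Pt → ℂ, f =ᵐ[graphMeasure] u ∧ EdgewisePrimitive f v ∧ VertexContinuous f

/-- `u ∈ H¹_c(Γ)`. -/
def MemH1c (u : L2) : Prop := ∃ v : L2, IsH1cDeriv u v

open Classical in
/-- The derivative `u' ∈ L²(Γ)` of `u ∈ H¹_c(Γ)` (and `0` if `u ∉ H¹_c(Γ)`). -/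
def h1Deriv (u : L2) : L2 := if h : MemH1c u then h.choose else 0

/-- `u ∈ D(Δ)` with `Δ u = w`: `u ∈ H²(Γ) ∩ H¹_c(Γ)` satisfies the flux condition at the vertices
and has the second edgewise derivative `w`. -/
def IsLaplacian (u w : L2) : Prop :=
  ∃ v : L2, IsH1cDeriv u v ∧
    ∃ g : Pt → ℂ, g =ᵐ[graphMeasure] v ∧ EdgewisePrimitive g w ∧ VertexFlux g

/-! ## Spectrum and functional calculus of an unbounded operator

An operator `A` in a Hilbert space is given by its graph: `A u f` means `u ∈ D(A)` and `A u = f`. -/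

/-- `R` is the bounded inverse of `A - z`: `R f = u` if and only if `u ∈ D(A)` and
`A u - z u = f`. -/
def IsResolventAt {E : Type*} [NormedAddCommGroup E] [InnerProductSpace ℂ E]
    (A : E → E → Prop) (z : ℂ) (R : E →L[ℂ] E) : Prop :=
  ∀ f u : E, R f = u ↔ A u (f + z • u)

/-- The spectrum of `A`. -/
def opSpectrum {E : Type*} [NormedAddCommGroup E] [InnerProductSpace ℂ E]
    (A : E → E → Prop) : Set ℂ :=
  {z | ¬ ∃ R : E →L[ℂ] E, IsResolventAt A z R}

open Classical in
/-- The bounded operator `A⁻¹` (and `0` if `0` is in the spectrum of `A`). -/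
def opInverse {E : Type*} [NormedAddCommGroup E] [InnerProductSpace ℂ E]
    (A : E → E → Prop) : E →L[ℂ] E :=
  if h : ∃ R : E →L[ℂ] E, IsResolventAt A 0 R then h.choose else 0

/-- For a self-adjoint operator `A` with `0` in its resolvent set: the bounded operator
`|A|^{-1/2} = |A⁻¹|^{1/2}`, by the functional calculus of the bounded self-adjoint operator `A⁻¹`. -/
def invSqrtAbs {E : Type*} [NormedAddCommGroup E] [InnerProductSpace ℂ E] [CompleteSpace E]
    (A : E → E → Prop) : E →L[ℂ] E :=
  cfc (fun x : ℝ => Real.sqrt |x|) (opInverse A)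

/-- For a self-adjoint operator `A` with `0` in its resolvent set: the closed form
`b_{|A|}(v, v) = ‖ |A|^{1/2} v ‖²` of `|A|`.  The injective operator `|A|^{-1/2}` maps at most one
`w` to `v`, namely `w = |A|^{1/2} v`, and the value is `∞` if `v ∉ D(|A|^{1/2})`. -/
def absForm {E : Type*} [NormedAddCommGroup E] [InnerProductSpace ℂ E] [CompleteSpace E]
    (A : E → E → Prop) (v : E) : ℝ≥0∞ :=
  ⨅ (w : E) (_ : invSqrtAbs A w = v), ENNReal.ofReal (‖w‖ ^ 2)

/-! ## The operators `L_k` -/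

/-- The temporal frequency `ω = 2π / T`. -/
def freq (T : ℝ) : ℝ := 2 * Real.pi / T

/-- The set `κ ℤ_odd`. -/
def oddMultiples (κ : ℤ) : Set ℤ := {k | ∃ m : ℤ, Odd m ∧ k = κ * m}

/-- The graph of the operator `L_k = -d²/dx² - ω²k² + α` in `L²(Γ)_symm`, with domain
`D(Δ)_symm`: `OpL T α k u f` means `u ∈ D(L_k)` and `L_k u = f`. -/
def OpL (T α : ℝ) (k : ℤ) (u f : L2symm) : Prop :=
  ∃ w : L2, IsLaplacian u w ∧
    (f : L2) = -w + ((-(freq T) ^ 2 * (k : ℝ) ^ 2 + α : ℝ) : ℂ) • (u : L2)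

/-- The spectral condition: `0` is not in the closure of the union of the spectra of the `L_k`
with `k ∈ κ ℤ_odd`. -/
def SpecCondition (T α : ℝ) (κ : ℤ) : Prop :=
  (0 : ℂ) ∉ closure (⋃ k ∈ oddMultiples κ, opSpectrum (OpL T α k))

/-! ## The two spaces of time-periodic functions `u(x,t) = ∑ u_k(x) e^{iωkt}` -/

/-- Coefficient families of real-valued functions `∑ u_k e^{iωkt}` with `u_k ∈ H¹_c(Γ)_symm` and
`k ∈ κ ℤ_odd`. -/
def Admissible (κ : ℤ) (u : ℤ → L2symm) : Prop :=
  (∀ k ∉ oddMultiples κ, u k = 0) ∧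
    (∀ k ∈ oddMultiples κ, MemH1c (u k) ∧ star (u k : L2) = (u (-k) : L2))

/-- The norm `(∑ b_{|L_k|}(u_k, u_k))^{1/2}` of the space `𝓗`, where `0` is in the resolvent set of
every `L_k`. -/
def calHNorm (T α : ℝ) (κ : ℤ) (u : ℤ → L2symm) : ℝ≥0∞ :=
  (∑' k : oddMultiples κ, absForm (OpL T α k) (u k)) ^ (1 / 2 : ℝ)

/-- The space `𝓗`. -/
def calH (T α : ℝ) (κ : ℤ) : Set (ℤ → L2symm) :=
  {u | Admissible κ u ∧ calHNorm T α κ u < ∞}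

/-- The norm `(∑ |k|⁻¹ ‖u_k'‖² + |k| ‖u_k‖²)^{1/2}` of the space `H`. -/
def hNorm (κ : ℤ) (u : ℤ → L2symm) : ℝ≥0∞ :=
  (∑' k : oddMultiples κ, ENNReal.ofReal
    (1 / |((k : ℤ) : ℝ)| * ‖h1Deriv (u k)‖ ^ 2 + |((k : ℤ) : ℝ)| * ‖u k‖ ^ 2)) ^ (1 / 2 : ℝ)

/-- The space `H`. -/
def H (κ : ℤ) : Set (ℤ → L2symm) :=
  {u | Admissible κ u ∧ hNorm κ u < ∞}

/-- The measure on `Γ × 𝕋_T`, where the torus of length `T` carries the measure of mass `T`. -/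
def spaceTimeMeasure (T : ℝ) [Fact (0 < T)] : Measure (Pt × AddCircle T) :=
  graphMeasure.prod volume

/-- `U = ∑ u_k(x) e^{iωkt}` with (unconditional) convergence in `L²(Γ × 𝕋_T)`.
Here `fourier k t = e^{2πikt/T} = e^{iωkt}`. -/
def IsTimeSeries (T : ℝ) [Fact (0 < T)] (u : ℤ → L2symm) (U : Pt × AddCircle T → ℂ) : Prop :=
  MemLp U 2 (spaceTimeMeasure T) ∧
    Filter.Tendsto
      (fun s : Finset ℤ =>
        eLpNorm (fun p => U p - ∑ k ∈ s, (u k : L2) p.1 * fourier k p.2) 2 (spaceTimeMeasure T))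
      Filter.atTop (nhds 0)

/-- `𝓗` embeds continuously into `H`. -/
def CalHEmbedsIntoH (T α : ℝ) (κ : ℤ) : Prop :=
  ∃ C : ℝ≥0, ∀ u ∈ calH T α κ, u ∈ H κ ∧ hNorm κ u ≤ C * calHNorm T α κ u

/-- `H` embeds continuously into `L^q(Γ × 𝕋_T)`: every element of `H` is a function on `Γ × 𝕋_T`,
different elements are different functions, and these functions belong to `L^q` with
`‖U‖_{L^q} ≤ C ‖u‖_H`. -/
def HEmbedsIntoLq (T : ℝ) [Fact (0 < T)] (κ : ℤ) (q : ℝ) : Prop :=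
  (∀ u ∈ H κ, ∃ U, IsTimeSeries T u U) ∧
  (∀ u ∈ H κ, ∀ v ∈ H κ, ∀ U, IsTimeSeries T u U → IsTimeSeries T v U → u = v) ∧
  ∃ C : ℝ≥0, ∀ u ∈ H κ, ∀ U, IsTimeSeries T u U →
    MemLp U (ENNReal.ofReal q) (spaceTimeMeasure T) ∧
      eLpNorm U (ENNReal.ofReal q) (spaceTimeMeasure T) ≤ C * hNorm κ u

/-! ## Conditions on the frequency -/

/-- The band functions, i.e. the quasiperiodic eigenvalues of the Kirchhoff Laplacian:
`λ_m(l) = (arccos((8 cos(2πl) + 1) / 9) / (2π) + m)²`. -/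
def band (m : ℤ) (l : ℝ) : ℝ :=
  (1 / (2 * Real.pi) * Real.arccos (1 / 9 * (8 * Real.cos (2 * Real.pi * l) + 1)) + m) ^ 2

/-- For some `K`, the distance of `√λ_m(l)` and `√(ω²k² - α)` is bounded away from `0`, uniformly
in `l ∈ (-1/2, 1/2]`, `m ∈ ℤ` and `k ∈ κ ℤ_odd` with `|k| > K`; here `K` is so large that
`ω²k² ≥ α` for these `k`. -/
def GapCondition (T α : ℝ) (κ : ℤ) : Prop :=
  ∃ K : ℕ, ∃ δ > 0, ∀ l ∈ Set.Ioc (-(1 / 2) : ℝ) (1 / 2), ∀ m : ℤ, ∀ k ∈ oddMultiples κ,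
    (K : ℤ) < |k| → α ≤ (freq T) ^ 2 * (k : ℝ) ^ 2 ∧
      δ ≤ |Real.sqrt (band m l) - Real.sqrt ((freq T) ^ 2 * (k : ℝ) ^ 2 - α)|

end Necklace

end

/-! Embedding of `calH` into `H`. Let R be the inverse of L_k and w = |L_k|^{1/2} v, so that v =
|R|^{1/2} w. Then ‖v‖² ≤ ‖R‖ ‖w‖². Moreover ‖v'‖² = ⟨v, L_k v⟩ + (ω²k² - α)‖v‖² ≤ (1 + ω²k²‖R‖)
‖w‖², first for v in the domain of L_k and then by density. Both summands of the norm of `H` are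
thus controlled once ‖R‖ = O(1/|k|). The spectral condition provides R for each k, and finitely many
k cause no difficulty; the decay for large k comes from the gaps.

With s = √(ω²k² - α), the number s² lies in a spectral gap of -Δ exactly when 9 cos²(πs) < 1,
because the bands are given by cos(2πs) ∈ [-7/9, 1]. Either frequency condition yields 9 cos²(πs) ≤
1 - ε for large k (`cosCondition_of_half`, `GapCondition.cosCondition`). The resolvent bound s‖R‖ ≤
C(ε) is then proved directly, without Floquet-Bloch theory (`IsLaplacian.sq_norm_le`). Testing the
equation with sines on each edge and eliminating the derivatives by Kirchhoff's condition leaves a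
recursion for the values W_n at 2πn and V_n at 2πn + π: up to errors O(1/s), W_n + 2W_{n+1} = 3cV_n
and V_{n+1} + 2V_n = 3cW_{n+1}, where c = cos(πs). In ℓ² the left sides dominate W and V with
constant 2 - 1 = 1, while 3|c| < 1, so the recursion is invertible.

Embedding of `H` into L^q. Let a_k be the k-th term of the squared norm and A their sum. The trace
estimate at length scale 1/|k| gives |u_k|² ≤ 2a_k pointwise. At level l, the frequencies with |k| ≤
l²/(16A) contribute at most l/2 by Cauchy-Schwarz, and Chebyshev with orthogonality bounds the
measure where the rest exceeds l/2 (`meas_lt_norm_le`). Integration against q l^{q-1} turns the k-th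
term into a multiple of A^{(q-2)/2} a_k |k|^{(q-2)/2 - 1}, which is summable for 2 < q < 4. The case
q = 2 is Bessel's inequality. -/

open MeasureTheory
open scoped ENNReal NNReal

noncomputable section

namespace Necklace

/-! ### Decomposition of the measure of the graph into edges -/

/-- Lebesgue measure on the edge `i = (n, j)`. -/
def edgeMeasure (i : ℤ × SignType) : Measure ℝ := volume.restrict (edge i.1 i.2)

/-- Inclusion of the edge `i = (n, j)` into the ambient space of the graph. -/
def edgeMap (i : ℤ × SignType) (x : ℝ) : Pt := (i.1, i.2, x)

instance (i : ℤ × SignType) : IsFiniteMeasure (edgeMeasure i) := by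
  unfold edgeMeasure edge
  infer_instance

theorem measurableEmbedding_edgeMap (i : ℤ × SignType) : MeasurableEmbedding (edgeMap i) :=
  (measurableEmbedding_prodMk_left i.1).comp (measurableEmbedding_prodMk_left i.2)

theorem measurableSet_graphSet : MeasurableSet graphSet := by
  have hstart : Measurable fun p : Pt => edgeStart p.1 p.2.1 := by
    have h1 : Measurable fun q : ℤ × SignType => edgeStart q.1 q.2 := measurable_of_countable _
    exact h1.comp (measurable_fst.prodMk (measurable_fst.comp measurable_snd))
  have hx : Measurable fun p : Pt => p.2.2 := measurable_snd.comp measurable_snd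
  exact (measurableSet_le hstart hx).inter (measurableSet_le hx (hstart.add_const Real.pi))

/-- Reduces almost-everywhere statements and integrals on the graph to statements on intervals. -/
theorem graphMeasure_eq_sum :
    graphMeasure = Measure.sum fun i => (edgeMeasure i).map (edgeMap i) := by
  ext s hs
  rw [Measure.sum_apply _ hs, graphMeasure, Measure.restrict_apply hs,
    Measure.prod_apply (hs.inter measurableSet_graphSet), lintegral_count, ENNReal.tsum_prod']
  refine tsum_congr fun n => ?_
  rw [Measure.prod_apply (measurable_prodMk_left (hs.inter measurableSet_graphSet)),
    lintegral_count]
  refine tsum_congr fun j => ?_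
  rw [(measurableEmbedding_edgeMap _).map_apply, edgeMeasure,
    Measure.restrict_apply ((measurableEmbedding_edgeMap _).measurable hs)]
  rfl

theorem ae_graph_iff {P : Pt → Prop} :
    (∀ᵐ p ∂graphMeasure, P p) ↔ ∀ i, ∀ᵐ y ∂edgeMeasure i, P (edgeMap i y) := by
  rw [graphMeasure_eq_sum, Measure.ae_sum_iff]
  exact forall_congr' fun i => (measurableEmbedding_edgeMap i).ae_map_iff

theorem hasSum_integral_graph {F : Pt → ℂ} (hF : Integrable F graphMeasure) :
    HasSum (fun i => ∫ y, F (edgeMap i y) ∂edgeMeasure i) (∫ p, F p ∂graphMeasure) := by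
  rw [graphMeasure_eq_sum] at hF ⊢
  have h := hasSum_integral_measure hF
  simpa only [(measurableEmbedding_edgeMap _).integral_map] using h

/-- The restriction of `u ∈ L²(Γ)` to an edge. -/
def onEdge (u : L2) (i : ℤ × SignType) (y : ℝ) : ℂ := u (edgeMap i y)

theorem memLp_onEdge (u : L2) (i : ℤ × SignType) : MemLp (onEdge u i) 2 (edgeMeasure i) := by
  have h : (edgeMeasure i).map (edgeMap i) ≤ graphMeasure := by
    rw [graphMeasure_eq_sum]
    exact Measure.le_sum _ i
  have h2 := (Lp.memLp u).mono_measure h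
  exact (measurableEmbedding_edgeMap i).memLp_map_measure_iff.1 h2

/-- The squared norm of `u` on an edge. -/
def edgeSq (u : L2) (i : ℤ × SignType) : ℝ := ∫ y, ‖onEdge u i y‖ ^ 2 ∂edgeMeasure i

theorem edgeSq_nonneg (u : L2) (i : ℤ × SignType) : 0 ≤ edgeSq u i :=
  integral_nonneg fun _ => by positivity

theorem hasSum_edgeInner (u v : L2) :
    HasSum (fun i => ∫ y, starRingEnd ℂ (onEdge u i y) * onEdge v i y ∂edgeMeasure i)
      (inner ℂ u v) := by
  have h := hasSum_integral_graph (L2.integrable_inner (𝕜 := ℂ) u v)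
  rw [L2.inner_def]
  convert h using 4
  simp [onEdge, mul_comm]

theorem hasSum_edgeSq (u : L2) : HasSum (edgeSq u) (‖u‖ ^ 2) := by
  have h := hasSum_edgeInner u u
  rw [← Complex.hasSum_ofReal]
  convert h using 1
  · ext i
    rw [edgeSq, ← integral_complex_ofReal]
    congr 1 with y
    rw [mul_comm, Complex.mul_conj, Complex.normSq_eq_norm_sq]
  · rw [inner_self_eq_norm_sq_to_K]
    simp

theorem edgeSq_le (u : L2) (i : ℤ × SignType) : edgeSq u i ≤ ‖u‖ ^ 2 :=
  le_hasSum (hasSum_edgeSq u) i fun j _ => edgeSq_nonneg u j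

theorem onEdge_congr {f : Pt → ℂ} {u : L2} (h : f =ᵐ[graphMeasure] u) (i : ℤ × SignType) :
    (fun y => f (edgeMap i y)) =ᵐ[edgeMeasure i] onEdge u i :=
  ae_graph_iff.1 h i

theorem onEdge_sub (u v : L2) (i : ℤ × SignType) :
    onEdge (u - v) i =ᵐ[edgeMeasure i] onEdge u i - onEdge v i :=
  ae_graph_iff.1 (Lp.coeFn_sub u v) i

theorem onEdge_add (u v : L2) (i : ℤ × SignType) :
    onEdge (u + v) i =ᵐ[edgeMeasure i] onEdge u i + onEdge v i :=
  ae_graph_iff.1 (Lp.coeFn_add u v) i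

theorem onEdge_smul (c : ℂ) (u : L2) (i : ℤ × SignType) :
    onEdge (c • u) i =ᵐ[edgeMeasure i] c • onEdge u i :=
  ae_graph_iff.1 (Lp.coeFn_smul c u) i

theorem L2.ext_onEdge {u v : L2} (h : ∀ i, onEdge u i =ᵐ[edgeMeasure i] onEdge v i) : u = v :=
  Lp.ext (ae_graph_iff.2 h)

/-! ### Absolutely continuous functions on an interval -/

/-- On `[a, b]`, the function `f` is a primitive of the integrable function `v`. -/
structure IsPrimOn (a b : ℝ) (f v : ℝ → ℂ) : Prop where
  integrable : Integrable v (volume.restrict (Set.Icc a b))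
  eq_add : ∀ x ∈ Set.Icc a b, f x = f a + ∫ y in a..x, v y

/-- Increments of the primitive of v are dominated by those of the primitive of ‖v‖, whose absolute
continuity is known. -/
theorem absolutelyContinuous_primitive {a b : ℝ} {v : ℝ → ℂ} (c : ℂ)
    (hv : IntervalIntegrable v volume a b) :
    AbsolutelyContinuousOnInterval (fun x => c + ∫ y in a..x, v y) a b := by
  have h := hv.norm.absolutelyContinuousOnInterval_intervalIntegral (c := a) Set.left_mem_uIcc
  rw [absolutelyContinuousOnInterval_iff] at h ⊢
  intro ε hε
  obtain ⟨δ, hδ, H⟩ := h ε hε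
  refine ⟨δ, hδ, fun E hE hs => lt_of_le_of_lt (Finset.sum_le_sum fun i hi => ?_) (H E hE hs)⟩
  have hsub : ∀ z ∈ Set.uIcc a b, IntervalIntegrable v volume a z := fun z hz =>
    hv.mono_set (Set.uIcc_subset_uIcc Set.left_mem_uIcc hz)
  have hmem := hE.1 i (by simpa using hi)
  rw [dist_add_left, dist_eq_norm, dist_eq_norm,
    intervalIntegral.integral_interval_sub_left (hsub _ hmem.1) (hsub _ hmem.2),
    intervalIntegral.integral_interval_sub_left (hsub _ hmem.1).norm (hsub _ hmem.2).norm,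
    Real.norm_eq_abs]
  exact intervalIntegral.norm_integral_le_abs_integral_norm

namespace IsPrimOn

variable {a b : ℝ} {f v g w : ℝ → ℂ}

theorem intervalIntegrable (h : IsPrimOn a b f v) (hab : a ≤ b) :
    IntervalIntegrable v volume a b :=
  (intervalIntegrable_iff_integrableOn_Icc_of_le hab).2 h.integrable

theorem intervalIntegrable_mem (h : IsPrimOn a b f v) {x y : ℝ} (hx : x ∈ Set.Icc a b)
    (hy : y ∈ Set.Icc a b) : IntervalIntegrable v volume x y := by
  have hab := hx.1.trans hx.2
  exact (h.intervalIntegrable hab).mono_set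
    (Set.uIcc_subset_uIcc (by rwa [Set.uIcc_of_le hab]) (by rwa [Set.uIcc_of_le hab]))

theorem sub_eq (h : IsPrimOn a b f v) {x y : ℝ} (hx : x ∈ Set.Icc a b) (hy : y ∈ Set.Icc a b) :
    f x - f y = ∫ z in y..x, v z := by
  have ha : a ∈ Set.Icc a b := Set.left_mem_Icc.2 (hx.1.trans hx.2)
  rw [h.eq_add x hx, h.eq_add y hy, add_sub_add_left_eq_sub,
    intervalIntegral.integral_interval_sub_left (h.intervalIntegrable_mem ha hx)
      (h.intervalIntegrable_mem ha hy)]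

theorem mono (h : IsPrimOn a b f v) {c d : ℝ} (hc : a ≤ c) (hd : d ≤ b) :
    IsPrimOn c d f v := by
  refine ⟨h.integrable.mono_measure (Measure.restrict_mono (Set.Icc_subset_Icc hc hd) le_rfl),
    fun x hx => ?_⟩
  rw [← h.sub_eq ⟨hc.trans hx.1, hx.2.trans hd⟩ ⟨hc, (hx.1.trans hx.2).trans hd⟩]
  ring

theorem absolutelyContinuous (h : IsPrimOn a b f v) (hab : a ≤ b) :
    AbsolutelyContinuousOnInterval (fun x => f a + ∫ y in a..x, v y) a b :=
  absolutelyContinuous_primitive _ (h.intervalIntegrable hab)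

theorem continuousOn (h : IsPrimOn a b f v) (hab : a ≤ b) : ContinuousOn f (Set.Icc a b) := by
  have h1 := (h.absolutelyContinuous hab).continuousOn
  rw [Set.uIcc_of_le hab] at h1
  exact h1.congr h.eq_add

theorem of_hasDerivAt (hf : ∀ x, HasDerivAt f (v x) x) (hv : Continuous v) :
    IsPrimOn a b f v := by
  refine ⟨hv.integrableOn_Icc, fun x hx => ?_⟩
  rw [intervalIntegral.integral_eq_sub_of_hasDerivAt (fun y _ => hf y)
    (hv.intervalIntegrable _ _)]
  ring

/-- Integration by parts. -/
theorem integral_mul (hf : IsPrimOn a b f v) (hg : IsPrimOn a b g w) (hab : a ≤ b) :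
    ∫ x in a..b, (v x * g x + f x * w x) = f b * g b - f a * g a := by
  set F := fun x => f a + ∫ y in a..x, v y with hF
  set G := fun x => g a + ∫ y in a..x, w y with hG
  have hFac := hf.absolutelyContinuous hab
  have hGac := hg.absolutelyContinuous hab
  have hint : IntervalIntegrable (fun x => v x * G x + F x * w x) volume a b :=
    ((hf.intervalIntegrable hab).mul_continuousOn hGac.continuousOn).add
      ((hg.intervalIntegrable hab).continuousOn_mul hFac.continuousOn)
  -- Since v and w are merely integrable, the product rule holds only almost everywhere. The product
  -- minus the expected primitive is absolutely continuous with derivative zero almost everywhere,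
  -- hence constant.
  have hac := (hFac.smul hGac).sub (absolutelyContinuous_primitive 0 hint)
  obtain ⟨C, hC⟩ := hac.const_of_ae_hasDerivAt_zero (by
    filter_upwards [(hf.intervalIntegrable hab).ae_hasDerivAt_integral,
      (hg.intervalIntegrable hab).ae_hasDerivAt_integral, hint.ae_hasDerivAt_integral]
      with x h1 h2 h3 hx
    have h1' := (h1 hx a Set.left_mem_uIcc).const_add (f a)
    have h2' := (h2 hx a Set.left_mem_uIcc).const_add (g a)
    have h3' := (h3 hx a Set.left_mem_uIcc).const_add 0
    have := (h1'.mul h2').sub h3'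
    rw [sub_self] at this
    exact this)
  have hCa := hC a Set.left_mem_uIcc
  have hCb := hC b Set.right_mem_uIcc
  have hb : b ∈ Set.Icc a b := Set.right_mem_Icc.2 hab
  have ha : a ∈ Set.Icc a b := Set.left_mem_Icc.2 hab
  have heq : ∫ x in a..b, (v x * g x + f x * w x) = ∫ x in a..b, (v x * G x + F x * w x) := by
    refine intervalIntegral.integral_congr fun x hx => ?_
    rw [Set.uIcc_of_le hab] at hx
    simp only [hF, hG, ← hf.eq_add x hx, ← hg.eq_add x hx]
  simp only [Pi.sub_apply, Pi.mul_apply, smul_eq_mul, intervalIntegral.integral_same,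
    zero_add, add_zero, ← hf.eq_add b hb, ← hg.eq_add b hb] at hCa hCb
  rw [heq]
  linear_combination hCa - hCb

theorem sub (hf : IsPrimOn a b f v) (hg : IsPrimOn a b g w) :
    IsPrimOn a b (f - g) (v - w) := by
  refine ⟨hf.integrable.sub hg.integrable, fun x hx => ?_⟩
  have ha : a ∈ Set.Icc a b := Set.left_mem_Icc.2 (hx.1.trans hx.2)
  simp only [Pi.sub_apply]
  rw [intervalIntegral.integral_sub (hf.intervalIntegrable_mem ha hx)
    (hg.intervalIntegrable_mem ha hx), hf.eq_add x hx, hg.eq_add x hx]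
  ring

theorem star (hf : IsPrimOn a b f v) :
    IsPrimOn a b (fun x => starRingEnd ℂ (f x)) (fun x => starRingEnd ℂ (v x)) := by
  refine ⟨(Complex.conjCLE.toContinuousLinearMap.integrable_comp hf.integrable), fun x hx => ?_⟩
  rw [hf.eq_add x hx, map_add, intervalIntegral.intervalIntegral_eq_integral_uIoc,
    intervalIntegral.intervalIntegral_eq_integral_uIoc, integral_conj]
  simp only [Complex.real_smul, map_mul, Complex.conj_ofReal]

/-- By Lebesgue differentiation, v is almost everywhere the derivative of its primitive, which here
vanishes identically. -/
theorem deriv_eq_zero (h : IsPrimOn a b f v) (hab : a ≤ b) {c : ℂ}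
    (hf : ∀ x ∈ Set.Icc a b, f x = c) : v =ᵐ[volume.restrict (Set.Icc a b)] 0 := by
  rw [← Measure.restrict_congr_set Ioo_ae_eq_Icc]
  filter_upwards [ae_restrict_of_ae (h.intervalIntegrable hab).ae_hasDerivAt_integral,
    ae_restrict_mem measurableSet_Ioo] with x hx hxm
  have h1 := hx (by rw [Set.uIcc_of_le hab]; exact Set.Ioo_subset_Icc_self hxm) a
    Set.left_mem_uIcc
  refine h1.unique (HasDerivAt.congr_of_eventuallyEq (hasDerivAt_const x (0 : ℂ)) ?_)
  filter_upwards [Ioo_mem_nhds hxm.1 hxm.2] with y hy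
  have h2 := h.eq_add y (Set.Ioo_subset_Icc_self hy)
  rw [hf y (Set.Ioo_subset_Icc_self hy), hf a (Set.left_mem_Icc.2 hab)] at h2
  simpa using h2.symm

theorem eqOn_of_ae (hab : a < b) (hf : ContinuousOn f (Set.Icc a b))
    (hg : ContinuousOn g (Set.Icc a b)) (h : f =ᵐ[volume.restrict (Set.Icc a b)] g) :
    Set.EqOn f g (Set.Icc a b) :=
  Measure.eqOn_Icc_of_ae_eq volume hab.ne h hf hg

theorem deriv_unique (hf : IsPrimOn a b f v) (hg : IsPrimOn a b g w) (hab : a < b)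
    (h : f =ᵐ[volume.restrict (Set.Icc a b)] g) : v =ᵐ[volume.restrict (Set.Icc a b)] w := by
  have he := eqOn_of_ae hab (hf.continuousOn hab.le) (hg.continuousOn hab.le) h
  have := (hf.sub hg).deriv_eq_zero hab.le (c := 0) fun x hx => by simp [he hx]
  filter_upwards [this] with x hx
  exact sub_eq_zero.1 hx

end IsPrimOn

theorem sq_integral_norm_le {a b : ℝ} (hab : a < b) {v : ℝ → ℂ}
    (hv : MemLp v 2 (volume.restrict (Set.Icc a b))) :
    (∫ x in Set.Icc a b, ‖v x‖) ^ 2 ≤ (b - a) * ∫ x in Set.Icc a b, ‖v x‖ ^ 2 := by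
  have hint : Integrable (fun x => ‖v x‖) (volume.restrict (Set.Icc a b)) :=
    (hv.integrable (by norm_num)).norm
  have hsq : Integrable (fun x => ‖v x‖ ^ 2) (volume.restrict (Set.Icc a b)) :=
    hv.integrable_norm_pow (by norm_num)
  set I := ∫ x in Set.Icc a b, ‖v x‖
  -- Cauchy-Schwarz from the nonnegativity of the integral of (‖v‖ - c)², where c is the mean of
  -- ‖v‖.
  set c := I / (b - a) with hc
  have hpos : 0 < b - a := sub_pos.2 hab
  have h0 : 0 ≤ ∫ x in Set.Icc a b, (‖v x‖ ^ 2 - 2 * c * ‖v x‖ + c ^ 2) :=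
    integral_nonneg fun x => by
      show (0 : ℝ) ≤ ‖v x‖ ^ 2 - 2 * c * ‖v x‖ + c ^ 2
      nlinarith [sq_nonneg (‖v x‖ - c)]
  have hint' := hint.const_mul (2 * c)
  have hdiff : Integrable (fun x => ‖v x‖ ^ 2 - 2 * c * ‖v x‖)
      (volume.restrict (Set.Icc a b)) := hsq.sub hint'
  rw [integral_add hdiff (integrable_const _), integral_sub hsq hint', integral_const_mul, integral_const,
    measureReal_restrict_apply_univ, Real.volume_real_Icc_of_le hab.le, smul_eq_mul] at h0
  have hI : I = c * (b - a) := by rw [hc]; field_simp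
  change 0 ≤ _ - 2 * c * I + _ at h0
  rw [hI] at h0 ⊢
  nlinarith

/-- Trace estimate. -/
theorem IsPrimOn.norm_sq_le {a b : ℝ} {f v : ℝ → ℂ} (h : IsPrimOn a b f v) (hab : a < b)
    (hv : MemLp v 2 (volume.restrict (Set.Icc a b))) {x : ℝ} (hx : x ∈ Set.Icc a b) :
    ‖f x‖ ^ 2 ≤ 2 / (b - a) * (∫ y in Set.Icc a b, ‖f y‖ ^ 2) +
      2 * (b - a) * ∫ y in Set.Icc a b, ‖v y‖ ^ 2 := by
  have hpos : 0 < b - a := sub_pos.2 hab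
  set V := ∫ y in Set.Icc a b, ‖v y‖ ^ 2
  have hcs := sq_integral_norm_le hab hv
  have hfc : ContinuousOn (fun y => ‖f y‖ ^ 2) (Set.Icc a b) := (h.continuousOn hab.le).norm.pow 2
  have hfi : Integrable (fun y => ‖f y‖ ^ 2) (volume.restrict (Set.Icc a b)) :=
    hfc.integrableOn_Icc
  -- The value at x is compared with the value at an arbitrary y, and the inequality is then
  -- averaged over y.
  have hpt : ∀ y ∈ Set.Icc a b, ‖f x‖ ^ 2 ≤ 2 * ‖f y‖ ^ 2 + 2 * (b - a) * V := by
    intro y hy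
    have h1 : ‖f x - f y‖ ≤ ∫ z in Set.Icc a b, ‖v z‖ := by
      rw [h.sub_eq hx hy]
      refine intervalIntegral.norm_integral_le_integral_norm_uIoc.trans ?_
      refine setIntegral_mono_set h.integrable.norm (ae_of_all _ fun _ => norm_nonneg _) ?_
      refine (Set.uIoc_subset_uIcc.trans ?_).eventuallyLE
      rw [← Set.uIcc_of_le hab.le] at hx hy ⊢
      exact Set.uIcc_subset_uIcc hy hx
    have h2 : ‖f x‖ ≤ ‖f y‖ + ‖f x - f y‖ := by
      simpa using norm_add_le (f y) (f x - f y)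
    have h3 : ‖f x - f y‖ ^ 2 ≤ (b - a) * V := (pow_le_pow_left₀ (norm_nonneg _) h1 2).trans hcs
    have h4 : ‖f x‖ ^ 2 ≤ (‖f y‖ + ‖f x - f y‖) ^ 2 := pow_le_pow_left₀ (norm_nonneg _) h2 2
    nlinarith [sq_nonneg (‖f y‖ - ‖f x - f y‖)]
  have h5 : ∫ _ in Set.Icc a b, ‖f x‖ ^ 2 ≤
      ∫ y in Set.Icc a b, (2 * ‖f y‖ ^ 2 + 2 * (b - a) * V) :=
    setIntegral_mono_on (integrable_const _) ((hfi.const_mul 2).add (integrable_const _))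
      measurableSet_Icc hpt
  rw [integral_add (hfi.const_mul 2) (integrable_const _), integral_const, integral_const,
    measureReal_restrict_apply_univ, Real.volume_real_Icc_of_le hab.le, smul_eq_mul, smul_eq_mul,
    integral_const_mul] at h5
  rw [← mul_le_mul_iff_right₀ hpos]
  refine h5.trans (le_of_eq ?_)
  field_simp

/-! ### Functions in `H¹` on the graph -/

/-- The value of `f` at the left end of the edge `i`. -/
def leftEnd (f : Pt → ℂ) (i : ℤ × SignType) : ℂ := f (edgeMap i (edgeStart i.1 i.2))

/-- The value of `f` at the right end of the edge `i`. -/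
def rightEnd (f : Pt → ℂ) (i : ℤ × SignType) : ℂ := f (edgeMap i (edgeStart i.1 i.2 + Real.pi))

theorem sum_signType {M : Type*} [AddCommMonoid M] (F : SignType → M) :
    ∑ j, F j = F 0 + F 1 + F (-1) := by
  have h : (Finset.univ : Finset SignType) = {0, 1, -1} := by decide
  rw [h, Finset.sum_insert (by decide), Finset.sum_insert (by decide), Finset.sum_singleton,
    add_assoc]

theorem edgeStart_zero (n : ℤ) : edgeStart n 0 = 2 * Real.pi * n := if_pos rfl

theorem edgeStart_one (n : ℤ) : edgeStart n 1 = 2 * Real.pi * n + Real.pi := if_neg (by decide)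

theorem edgeStart_neg_one (n : ℤ) : edgeStart n (-1) = 2 * Real.pi * n + Real.pi :=
  if_neg (by decide)

theorem VertexContinuous.ends {f : Pt → ℂ} (hf : VertexContinuous f) (n : ℤ) :
    leftEnd f (n, 1) = rightEnd f (n, 0) ∧ leftEnd f (n, -1) = rightEnd f (n, 0) ∧
      rightEnd f (n, 1) = leftEnd f (n + 1, 0) ∧ rightEnd f (n, -1) = leftEnd f (n + 1, 0) := by
  have e : 2 * Real.pi * (n : ℝ) + Real.pi + Real.pi = 2 * Real.pi * (n + 1) := by ring
  simp only [leftEnd, rightEnd, edgeMap, edgeStart_zero, edgeStart_one, edgeStart_neg_one, e]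
  push_cast
  exact ⟨(hf n).1.1.symm, (hf n).1.2.symm, (hf n).2.1.symm, (hf n).2.2.symm⟩

theorem VertexFlux.ends {g : Pt → ℂ} (hg : VertexFlux g) (n : ℤ) :
    rightEnd g (n, 0) = leftEnd g (n, 1) + leftEnd g (n, -1) ∧
      leftEnd g (n + 1, 0) = rightEnd g (n, 1) + rightEnd g (n, -1) := by
  have e : 2 * Real.pi * (n : ℝ) + Real.pi + Real.pi = 2 * Real.pi * (n + 1) := by ring
  simp only [leftEnd, rightEnd, edgeMap, edgeStart_zero, edgeStart_one, edgeStart_neg_one, e]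
  push_cast
  exact hg n

theorem lt_edgeEnd (i : ℤ × SignType) : edgeStart i.1 i.2 < edgeStart i.1 i.2 + Real.pi :=
  lt_add_of_pos_right _ Real.pi_pos

theorem integrable_onEdge (u : L2) (i : ℤ × SignType) :
    Integrable (onEdge u i) (edgeMeasure i) :=
  (memLp_onEdge u i).integrable (by norm_num)

theorem EdgewisePrimitive.isPrimOn {f : Pt → ℂ} {v : L2} (h : EdgewisePrimitive f v)
    (i : ℤ × SignType) :
    IsPrimOn (edgeStart i.1 i.2) (edgeStart i.1 i.2 + Real.pi) (fun x => f (edgeMap i x))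
      (onEdge v i) :=
  ⟨integrable_onEdge v i, h i.1 i.2⟩

theorem sq_integral_norm_onEdge_le (u : L2) (i : ℤ × SignType) :
    (∫ x, ‖onEdge u i x‖ ∂edgeMeasure i) ^ 2 ≤ Real.pi * edgeSq u i := by
  have h := sq_integral_norm_le (lt_edgeEnd i) (memLp_onEdge u i)
  rwa [add_sub_cancel_left] at h

theorem edgeSq_eq {f : Pt → ℂ} {u : L2} (h : f =ᵐ[graphMeasure] u) (i : ℤ × SignType) :
    edgeSq u i = ∫ x, ‖f (edgeMap i x)‖ ^ 2 ∂edgeMeasure i := by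
  refine integral_congr_ae ?_
  filter_upwards [onEdge_congr h i] with x hx
  rw [hx]

/-- Trace estimate on an edge, at the length scale `h`. -/
theorem norm_sq_le_of_edgewisePrimitive {f : Pt → ℂ} {u v : L2} (hf : f =ᵐ[graphMeasure] u)
    (hp : EdgewisePrimitive f v) (i : ℤ × SignType) {x : ℝ} (hx : x ∈ edge i.1 i.2) {h : ℝ}
    (h0 : 0 < h) (hpi : h ≤ Real.pi) :
    ‖f (edgeMap i x)‖ ^ 2 ≤ 2 / h * edgeSq u i + 2 * h * edgeSq v i := by
  set a := edgeStart i.1 i.2 with ha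
  -- Left end of a subinterval of length h that contains x; it is shifted to the left when [x, x +
  -- h] would leave the edge.
  set c := min x (a + Real.pi - h) with hc
  have hxa : a ≤ x := hx.1
  have hxb : x ≤ a + Real.pi := hx.2
  have hac : a ≤ c := le_min hxa (by linarith)
  have hcb : c + h ≤ a + Real.pi := by linarith [min_le_right x (a + Real.pi - h)]
  have hxc : x ∈ Set.Icc c (c + h) := by
    refine ⟨min_le_left _ _, ?_⟩
    rcases min_choice x (a + Real.pi - h) with h1 | h1 <;> rw [hc, h1] <;> linarith
  have hle : volume.restrict (Set.Icc c (c + h)) ≤ edgeMeasure i :=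
    Measure.restrict_mono (Set.Icc_subset_Icc hac hcb) le_rfl
  have hprim := (hp.isPrimOn i).mono hac hcb
  have key := hprim.norm_sq_le (by linarith) ((memLp_onEdge v i).mono_measure hle) hxc
  rw [add_sub_cancel_left] at key
  refine key.trans ?_
  gcongr
  · rw [edgeSq_eq hf]
    refine integral_mono_measure hle (ae_of_all _ fun _ => by positivity) ?_
    have h2 := (memLp_onEdge u i).integrable_norm_pow (p := 2) (by norm_num)
    refine h2.congr ?_
    filter_upwards [onEdge_congr hf i] with y hy
    rw [hy]
  · exact integral_mono_measure hle (ae_of_all _ fun _ => by positivity)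
      ((memLp_onEdge v i).integrable_norm_pow (p := 2) (by norm_num))

theorem left_mem_edge (i : ℤ × SignType) : edgeStart i.1 i.2 ∈ edge i.1 i.2 :=
  Set.left_mem_Icc.2 (lt_edgeEnd i).le

theorem right_mem_edge (i : ℤ × SignType) : edgeStart i.1 i.2 + Real.pi ∈ edge i.1 i.2 :=
  Set.right_mem_Icc.2 (lt_edgeEnd i).le

/-- The trace estimate on each edge, summed. It supplies the decay at infinity needed for
telescoping over the cells. -/
theorem summable_sq_of_edgewisePrimitive {f : Pt → ℂ} {u v : L2} (hf : f =ᵐ[graphMeasure] u)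
    (hp : EdgewisePrimitive f v) {x : ℤ × SignType → ℝ} (hx : ∀ i, x i ∈ edge i.1 i.2) :
    Summable fun i => ‖f (edgeMap i (x i))‖ ^ 2 := by
  refine Summable.of_nonneg_of_le (fun _ => by positivity)
    (fun i => norm_sq_le_of_edgewisePrimitive hf hp i (hx i) zero_lt_one
      (by linarith [Real.pi_gt_three])) ?_
  exact ((hasSum_edgeSq u).summable.mul_left _).add ((hasSum_edgeSq v).summable.mul_left _)

/-- Green's identity. -/
theorem inner_deriv_eq {v w φ ψ : L2} {g : Pt → ℂ} (hg : g =ᵐ[graphMeasure] v)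
    (hgw : EdgewisePrimitive g w) (hflux : VertexFlux g) (hφ : IsH1cDeriv φ ψ) :
    inner ℂ ψ v = -inner ℂ φ w := by
  obtain ⟨f, hf, hfψ, hcont⟩ := hφ
  have hsum := (hasSum_edgeInner ψ v).add (hasSum_edgeInner φ w)
  have hedge : ∀ i : ℤ × SignType,
      ((∫ y, starRingEnd ℂ (onEdge ψ i y) * onEdge v i y ∂edgeMeasure i) +
        ∫ y, starRingEnd ℂ (onEdge φ i y) * onEdge w i y ∂edgeMeasure i) =
      starRingEnd ℂ (rightEnd f i) * rightEnd g i - starRingEnd ℂ (leftEnd f i) * leftEnd g i := by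
    intro i
    have hibp := ((hfψ.isPrimOn i).star).integral_mul (hgw.isPrimOn i) (lt_edgeEnd i).le
    refine Eq.trans ?_ hibp
    rw [intervalIntegral.integral_of_le (lt_edgeEnd i).le, ← integral_Icc_eq_integral_Ioc,
      ← integral_add]
    · refine integral_congr_ae ?_
      filter_upwards [onEdge_congr hf i, onEdge_congr hg i] with y h1 h2
      rw [← h1, ← h2]
    · exact (memLp_onEdge ψ i).star.integrable_mul (memLp_onEdge v i)
    · exact (memLp_onEdge φ i).star.integrable_mul (memLp_onEdge w i)
  simp only [hedge] at hsum
  have hcell := hsum.prod_fiberwise fun n => hasSum_fintype _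
  -- Within a cell the boundary terms at the vertex 2πn + π cancel by continuity and Kirchhoff's
  -- condition. What remains is B (n + 1) - B n, which sums to zero because B is summable.
  set B : ℤ → ℂ := fun n => starRingEnd ℂ (leftEnd f (n, 0)) * leftEnd g (n, 0) with hB
  have hBsum : Summable B := by
    have hinj : Function.Injective fun n : ℤ => (n, (0 : SignType)) := fun a b h => by
      simpa using h
    have h1 := (summable_sq_of_edgewisePrimitive hf hfψ left_mem_edge).comp_injective hinj
    have h2 := (summable_sq_of_edgewisePrimitive hg hgw left_mem_edge).comp_injective hinj
    refine Summable.of_norm_bounded (h1.add h2) fun n => ?_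
    simp only [hB, norm_mul, RCLike.norm_conj, Function.comp]
    change ‖leftEnd f (n, 0)‖ * ‖leftEnd g (n, 0)‖ ≤
      ‖leftEnd f (n, 0)‖ ^ 2 + ‖leftEnd g (n, 0)‖ ^ 2
    nlinarith [sq_nonneg (‖leftEnd f (n, 0)‖ - ‖leftEnd g (n, 0)‖),
      sq_nonneg (‖leftEnd f (n, 0)‖ + ‖leftEnd g (n, 0)‖)]
  have hshift : HasSum (fun n => B (n + 1)) (∑' n, B n) :=
    (Equiv.addRight (1 : ℤ)).hasSum_iff.2 hBsum.hasSum
  have hzero := hshift.sub hBsum.hasSum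
  rw [sub_self] at hzero
  have heq := hcell.unique (hzero.congr_fun fun n => by
    obtain ⟨c1, c2, c3, c4⟩ := hcont.ends n
    obtain ⟨k1, k2⟩ := hflux.ends n
    rw [sum_signType]
    simp only [c1, c2, c3, c4, k1, k2, hB]
    ring)
  exact eq_neg_of_add_eq_zero_left heq

/-! ### Uniqueness and closedness of the derivative, symmetry of the Laplacian -/

theorem IsH1cDeriv.unique {u v v' : L2} (h : IsH1cDeriv u v) (h' : IsH1cDeriv u v') : v = v' := by
  obtain ⟨f, hf, hp, -⟩ := h
  obtain ⟨f', hf', hp', -⟩ := h'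
  exact L2.ext_onEdge fun i => (hp.isPrimOn i).deriv_unique (hp'.isPrimOn i) (lt_edgeEnd i)
    ((onEdge_congr hf i).trans (onEdge_congr hf' i).symm)

theorem h1Deriv_eq {u v : L2} (h : IsH1cDeriv u v) : h1Deriv u = v := by
  have hm : MemH1c u := ⟨v, h⟩
  rw [h1Deriv, dif_pos hm]
  exact hm.choose_spec.unique h

theorem IsLaplacian.inner_deriv {u w : L2} (h : IsLaplacian u w) {φ ψ : L2}
    (hφ : IsH1cDeriv φ ψ) : inner ℂ ψ (h1Deriv u) = -inner ℂ φ w := by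
  obtain ⟨v, hv, g, hg, hgw, hflux⟩ := h
  rw [h1Deriv_eq hv]
  exact inner_deriv_eq hg hgw hflux hφ

theorem IsLaplacian.isH1cDeriv {u w : L2} (h : IsLaplacian u w) : IsH1cDeriv u (h1Deriv u) := by
  obtain ⟨v, hv, -⟩ := h
  rwa [h1Deriv_eq hv]

/-- The Laplacian is symmetric. -/
theorem IsLaplacian.inner_comm {u w u' w' : L2} (h : IsLaplacian u w) (h' : IsLaplacian u' w') :
    inner ℂ w u' = inner ℂ u w' := by
  have h1 := h.inner_deriv h'.isH1cDeriv
  have h2 := h'.inner_deriv h.isH1cDeriv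
  have h3 := inner_conj_symm (𝕜 := ℂ) (h1Deriv u) (h1Deriv u')
  rw [h1, h2, map_neg, inner_conj_symm] at h3
  exact neg_injective h3

theorem norm_h1Deriv_sq {u w : L2} (h : IsLaplacian u w) :
    ‖h1Deriv u‖ ^ 2 = -(inner ℂ u w : ℂ).re := by
  have h1 := h.inner_deriv h.isH1cDeriv
  rw [inner_self_eq_norm_sq_to_K] at h1
  have := congrArg Complex.re h1
  rw [Complex.neg_re] at this
  rw [← this]
  norm_cast

theorem IsLaplacian.eq_zero {w : L2} (h : IsLaplacian 0 w) : w = 0 := by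
  obtain ⟨v, hv, g, hg, hgw, -⟩ := h
  have hzero : ∀ i, onEdge 0 i =ᵐ[edgeMeasure i] 0 := ae_graph_iff.1 (Lp.coeFn_zero _ _ _)
  have hprim0 : ∀ i : ℤ × SignType, IsPrimOn (edgeStart i.1 i.2) (edgeStart i.1 i.2 + Real.pi)
      (fun _ => (0 : ℂ)) (fun _ => 0) := fun i =>
    .of_hasDerivAt (fun x => hasDerivAt_const x 0) continuous_const
  obtain ⟨f, hf, hp, -⟩ := hv
  have hv0 : ∀ i, onEdge v i =ᵐ[edgeMeasure i] fun _ => 0 := fun i =>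
    (hp.isPrimOn i).deriv_unique (hprim0 i) (lt_edgeEnd i) ((onEdge_congr hf i).trans (hzero i))
  exact L2.ext_onEdge fun i => ((hgw.isPrimOn i).deriv_unique (hprim0 i) (lt_edgeEnd i)
    ((onEdge_congr hg i).trans (hv0 i))).trans (hzero i).symm

/-- The derivative is a closed operator. -/
theorem IsH1cDeriv.eq_of_tendsto {u v g : L2} (h : IsH1cDeriv u v) {un vn : ℕ → L2}
    (hn : ∀ n, IsH1cDeriv (un n) (vn n)) (hu : Filter.Tendsto un Filter.atTop (nhds u))
    (hv : Filter.Tendsto vn Filter.atTop (nhds g)) : v = g := by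
  obtain ⟨f, hf, hp, -⟩ := h
  choose fn hfn hpn _ using hn
  obtain ⟨ns, hns, hae⟩ := (tendstoInMeasure_of_tendsto_Lp hu).exists_seq_tendsto_ae
  refine L2.ext_onEdge fun i => ?_
  set a := edgeStart i.1 i.2 with ha
  have hprim := hp.isPrimOn i
  have hpt : ∀ᵐ y ∂edgeMeasure i, Filter.Tendsto (fun k => fn (ns k) (edgeMap i y)) Filter.atTop
      (nhds (f (edgeMap i y))) := by
    have h1 : ∀ᵐ y ∂edgeMeasure i, ∀ k, fn (ns k) (edgeMap i y) = onEdge (un (ns k)) i y :=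
      ae_all_iff.2 fun k => onEdge_congr (hfn (ns k)) i
    filter_upwards [h1, onEdge_congr hf i, ae_graph_iff.1 hae i] with y h2 h3 h4
    simp only [h2]
    rw [h3]
    exact h4
  have hmem : ∀ᵐ y ∂edgeMeasure i, y ∈ edge i.1 i.2 := ae_restrict_mem measurableSet_Icc
  have hne : (ae (edgeMeasure i)).NeBot := by
    rw [ae_neBot, edgeMeasure, Ne, Measure.restrict_eq_zero, edge, Real.volume_Icc]
    simp [Real.pi_pos]
  -- Pointwise convergence of the subsequence is known only almost everywhere, possibly not at the
  -- end of the edge, so a good point y₀ serves as base point of the primitives.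
  obtain ⟨y₀, hy₀, hy₀m⟩ := (hpt.and hmem).exists
  have hint : ∀ w : L2, ∀ x ∈ edge i.1 i.2, ∀ y ∈ edge i.1 i.2,
      IntervalIntegrable (onEdge w i) volume x y := fun w x hx y hy =>
    ((intervalIntegrable_iff_integrableOn_Icc_of_le (lt_edgeEnd i).le).2
      (integrable_onEdge w i)).mono_set (Set.uIcc_subset_uIcc
        (by rwa [Set.uIcc_of_le (lt_edgeEnd i).le]) (by rwa [Set.uIcc_of_le (lt_edgeEnd i).le]))
  have hlim : ∀ x ∈ edge i.1 i.2, Filter.Tendsto (fun n => ∫ z in y₀..x, onEdge (vn n) i z)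
      Filter.atTop (nhds (∫ z in y₀..x, onEdge g i z)) := by
    intro x hx
    rw [tendsto_iff_norm_sub_tendsto_zero]
    have hb : Filter.Tendsto (fun n => Real.sqrt (Real.pi * ‖vn n - g‖ ^ 2)) Filter.atTop
        (nhds 0) := by
      have h1 := ((tendsto_iff_norm_sub_tendsto_zero.1 hv).pow 2).const_mul Real.pi
      simpa using h1.sqrt
    refine squeeze_zero (fun _ => norm_nonneg _) (fun n => ?_) hb
    refine Real.le_sqrt_of_sq_le ?_
    have h2 := sq_integral_norm_onEdge_le (vn n - g) i
    refine le_trans ?_ (h2.trans (mul_le_mul_of_nonneg_left (edgeSq_le _ _) Real.pi_pos.le))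
    gcongr
    rw [← intervalIntegral.integral_sub (hint _ _ hy₀m _ hx) (hint _ _ hy₀m _ hx)]
    refine intervalIntegral.norm_integral_le_integral_norm_uIoc.trans ?_
    have hsub : Set.uIoc y₀ x ⊆ edge i.1 i.2 :=
      Set.uIoc_subset_uIcc.trans (Set.uIcc_subset_Icc hy₀m hx)
    refine (setIntegral_mono_set ?_ (ae_of_all _ fun _ => norm_nonneg _)
      hsub.eventuallyLE).trans (le_of_eq ?_)
    · exact ((integrable_onEdge (vn n) i).sub (integrable_onEdge g i)).norm
    · refine integral_congr_ae ?_
      filter_upwards [onEdge_sub (vn n) g i] with z hz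
      rw [hz]
      rfl
  -- Passing to the limit in fn x - fn y₀ = ∫ vn shows that f agrees almost everywhere with this
  -- primitive of g.
  have hG : IsPrimOn a (a + Real.pi)
      (fun x => f (edgeMap i y₀) + ∫ z in y₀..x, onEdge g i z) (onEdge g i) := by
    refine ⟨integrable_onEdge g i, fun x hx => ?_⟩
    rw [add_assoc, intervalIntegral.integral_add_adjacent_intervals
      (hint _ _ hy₀m _ (left_mem_edge i)) (hint _ _ (left_mem_edge i) _ hx)]
  refine hprim.deriv_unique hG (lt_edgeEnd i) ?_
  change ∀ᵐ x ∂edgeMeasure i, _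
  filter_upwards [hpt, hmem] with x hx hxm
  have h5 := (hx.sub hy₀).add_const (f (edgeMap i y₀))
  have h6 := ((hlim x hxm).comp hns.tendsto_atTop).const_add (f (edgeMap i y₀))
  rw [sub_add_cancel] at h5
  refine tendsto_nhds_unique h5 (h6.congr fun k => ?_)
  have := ((hpn (ns k)).isPrimOn i).sub_eq hxm hy₀m
  rw [Function.comp_apply, ← this]
  ring

/-! ### A priori estimate in the spectral gaps -/

namespace IsPrimOn

variable {a b s : ℝ} {f g w : ℝ → ℂ}

theorem congr_deriv {v : ℝ → ℂ} (h : IsPrimOn a b f v)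
    (hv : v =ᵐ[volume.restrict (Set.Icc a b)] g) : IsPrimOn a b f g := by
  refine ⟨h.integrable.congr hv, fun x hx => ?_⟩
  rw [h.eq_add x hx, intervalIntegral.integral_of_le hx.1, intervalIntegral.integral_of_le hx.1]
  congr 1
  refine integral_congr_ae (ae_restrict_of_ae_restrict_of_subset ?_ hv)
  exact Set.Ioc_subset_Icc_self.trans (Set.Icc_subset_Icc_right hx.2)

/-- Green's second identity with a solution `φ` of `φ'' = -s² φ`. -/
theorem integral_helmholtz_mul (hf : IsPrimOn a b f g) (hg : IsPrimOn a b g w) (hab : a ≤ b)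
    {φ ψ : ℝ → ℝ} (hφ : ∀ x, HasDerivAt φ (ψ x) x) (hψ : ∀ x, HasDerivAt ψ (-s ^ 2 * φ x) x) :
    ∫ x in a..b, (w x + (s : ℂ) ^ 2 * f x) * (φ x : ℂ) =
      g b * φ b - f b * ψ b - (g a * φ a - f a * ψ a) := by
  have hφc : Continuous φ := continuous_iff_continuousAt.2 fun x => (hφ x).continuousAt
  have hψc : Continuous ψ := continuous_iff_continuousAt.2 fun x => (hψ x).continuousAt
  have h1 : IsPrimOn a b (fun x => (φ x : ℂ)) (fun x => (ψ x : ℂ)) :=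
    of_hasDerivAt (fun x => (hφ x).ofReal_comp) (by fun_prop)
  have h2 : IsPrimOn a b (fun x => (ψ x : ℂ)) (fun x => ((-s ^ 2 * φ x : ℝ) : ℂ)) :=
    of_hasDerivAt (fun x => (hψ x).ofReal_comp) (by fun_prop)
  have e1 := hg.integral_mul h1 hab
  have e2 := hf.integral_mul h2 hab
  have hu : ∀ {F : ℝ → ℂ}, ContinuousOn F (Set.Icc a b) → ContinuousOn F (Set.uIcc a b) := by
    intro F hF
    rwa [Set.uIcc_of_le hab]
  have i1 : IntervalIntegrable (fun x => w x * (φ x : ℂ) + g x * (ψ x : ℂ)) volume a b :=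
    ((hg.intervalIntegrable hab).mul_continuousOn (hu (h1.continuousOn hab))).add
      (((hg.continuousOn hab).mul (h2.continuousOn hab)).intervalIntegrable_of_Icc hab)
  have i2 : IntervalIntegrable
      (fun x => g x * (ψ x : ℂ) + f x * ((-s ^ 2 * φ x : ℝ) : ℂ)) volume a b :=
    ((hf.intervalIntegrable hab).mul_continuousOn (hu (h2.continuousOn hab))).add
      (((hf.continuousOn hab).mul (by fun_prop)).intervalIntegrable_of_Icc hab)
  rw [show g b * φ b - f b * ψ b - (g a * φ a - f a * ψ a) =
    (g b * φ b - g a * φ a) - (f b * ψ b - f a * ψ a) by ring, ← e1, ← e2,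
    ← intervalIntegral.integral_sub i1 i2]
  congr 1 with x
  push_cast
  ring

theorem integrable_helmholtz (hf : IsPrimOn a b f g) (hg : IsPrimOn a b g w) (hab : a ≤ b) :
    Integrable (fun x => w x + (s : ℂ) ^ 2 * f x) (volume.restrict (Set.Icc a b)) :=
  hg.integrable.add ((hf.continuousOn hab).const_smul ((s : ℂ) ^ 2)).integrableOn_Icc

theorem norm_integral_helmholtz_mul_le (hf : IsPrimOn a b f g) (hg : IsPrimOn a b g w)
    {x y : ℝ} (hx : a ≤ x) (hxy : x ≤ y) (hy : y ≤ b) {φ : ℝ → ℝ} (hφ : ∀ z, |φ z| ≤ 1) :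
    ‖∫ z in x..y, (w z + (s : ℂ) ^ 2 * f z) * (φ z : ℂ)‖ ≤
      ∫ z in Set.Icc a b, ‖w z + (s : ℂ) ^ 2 * f z‖ := by
  have hi := (hf.integrable_helmholtz (s := s) hg ((hx.trans hxy).trans hy)).norm
  have hsub : Set.uIoc x y ⊆ Set.Icc a b := by
    rw [Set.uIoc_of_le hxy]
    exact Set.Ioc_subset_Icc_self.trans (Set.Icc_subset_Icc hx hy)
  refine intervalIntegral.norm_integral_le_integral_norm_uIoc.trans ?_
  refine (integral_mono_of_nonneg (ae_of_all _ fun _ => norm_nonneg _)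
    (hi.mono_measure (Measure.restrict_mono hsub le_rfl)) (ae_of_all _ fun z => ?_)).trans
    (setIntegral_mono_set hi (ae_of_all _ fun _ => norm_nonneg _) hsub.eventuallyLE)
  simp only [norm_mul, Complex.norm_real, Real.norm_eq_abs]
  exact mul_le_of_le_one_right (norm_nonneg _) (hφ z)

/-- The test function sin(s(y - a)) vanishes at a, so the derivative of f at a drops out of Green's
identity on [a, x]. -/
theorem norm_left_le (hf : IsPrimOn a b f g) (hg : IsPrimOn a b g w) {x : ℝ}
    (hx : x ∈ Set.Icc a b) :
    ‖g x * Real.sin (s * (x - a)) - f x * (s * Real.cos (s * (x - a)) : ℝ) + f a * s‖ ≤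
      ∫ z in Set.Icc a b, ‖w z + (s : ℂ) ^ 2 * f z‖ := by
  have hd : ∀ y : ℝ, HasDerivAt (fun y => s * (y - a)) s y := fun y => by
    simpa using ((hasDerivAt_id y).sub_const a).const_mul s
  have h := integral_helmholtz_mul (s := s) (hf.mono le_rfl hx.2) (hg.mono le_rfl hx.2) hx.1
    (φ := fun y => Real.sin (s * (y - a))) (ψ := fun y => s * Real.cos (s * (y - a)))
    (fun y => by simpa [mul_comm] using (hd y).sin)
    (fun y => by
      refine ((hd y).cos.const_mul s).congr_deriv ?_
      ring)
  have h2 := norm_integral_helmholtz_mul_le (s := s) hf hg le_rfl hx.1 hx.2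
    (φ := fun y => Real.sin (s * (y - a))) fun _ => Real.abs_sin_le_one _
  rw [h] at h2
  simpa [sub_eq_add_neg, add_assoc] using h2

/-- Mirror image of `norm_left_le`: the test function sin(s(b - y)) removes the derivative at b. -/
theorem norm_right_le (hf : IsPrimOn a b f g) (hg : IsPrimOn a b g w) {x : ℝ}
    (hx : x ∈ Set.Icc a b) :
    ‖f b * s - g x * Real.sin (s * (b - x)) - f x * (s * Real.cos (s * (b - x)) : ℝ)‖ ≤
      ∫ z in Set.Icc a b, ‖w z + (s : ℂ) ^ 2 * f z‖ := by
  have hd : ∀ y : ℝ, HasDerivAt (fun y => s * (b - y)) (-s) y := fun y => by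
    simpa using ((hasDerivAt_id y).const_sub b).const_mul s
  have h := integral_helmholtz_mul (s := s) (hf.mono hx.1 le_rfl) (hg.mono hx.1 le_rfl) hx.2
    (φ := fun y => Real.sin (s * (b - y))) (ψ := fun y => -(s * Real.cos (s * (b - y))))
    (fun y => by
      refine (hd y).sin.congr_deriv ?_
      ring)
    (fun y => by
      refine ((hd y).cos.const_mul s).neg.congr_deriv ?_
      ring)
  have h2 := norm_integral_helmholtz_mul_le (s := s) hf hg hx.1 hx.2 le_rfl
    (φ := fun y => Real.sin (s * (b - y))) fun _ => Real.abs_sin_le_one _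
  rw [h] at h2
  refine le_trans (le_of_eq (congrArg _ ?_)) h2
  simp
  ring

/-- A solution of the Helmholtz equation is controlled by its boundary values. -/
theorem norm_le_of_ends (hf : IsPrimOn a b f g) (hg : IsPrimOn a b g w) (hs : 0 < s) {x : ℝ}
    (hx : x ∈ Set.Icc a b) :
    s * |Real.sin (s * (b - a))| * ‖f x‖ ≤ s * ‖f a‖ + s * ‖f b‖ +
      2 * ∫ z in Set.Icc a b, ‖w z + (s : ℂ) ^ 2 * f z‖ := by
  set D := ∫ z in Set.Icc a b, ‖w z + (s : ℂ) ^ 2 * f z‖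
  have hL := hf.norm_left_le (s := s) hg hx
  have hR := hf.norm_right_le (s := s) hg hx
  set L := g x * Real.sin (s * (x - a)) - f x * (s * Real.cos (s * (x - a)) : ℝ) + f a * s
  set R := f b * s - g x * Real.sin (s * (b - x)) - f x * (s * Real.cos (s * (b - x)) : ℝ)
  have hsin : Real.sin (s * (b - a)) = Real.sin (s * (x - a)) * Real.cos (s * (b - x)) +
      Real.cos (s * (x - a)) * Real.sin (s * (b - x)) := by
    rw [← Real.sin_add]
    ring_nf
  -- The combination of L and R with these sine weights eliminates g x; the coefficient of f x is
  -- collected by the addition formula.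
  have hid : (s * Real.sin (s * (b - a)) : ℝ) * f x =
      s * Real.sin (s * (b - x)) * f a + s * Real.sin (s * (x - a)) * f b -
        (Real.sin (s * (b - x)) * L + Real.sin (s * (x - a)) * R) := by
    rw [hsin]
    simp only [L, R]
    push_cast
    ring
  have hn := congrArg norm hid
  rw [norm_mul, Complex.norm_real, Real.norm_eq_abs, abs_mul, abs_of_pos hs] at hn
  rw [hn]
  have one : ∀ (t : ℝ) (z : ℂ), ‖(Real.sin t : ℂ) * z‖ ≤ ‖z‖ := fun t z => by
    rw [norm_mul, Complex.norm_real, Real.norm_eq_abs]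
    exact mul_le_of_le_one_left (norm_nonneg _) (Real.abs_sin_le_one _)
  have hs' : ∀ z : ℂ, ‖(s : ℂ) * z‖ = s * ‖z‖ := fun z => by
    rw [norm_mul, Complex.norm_real, Real.norm_of_nonneg hs.le]
  refine (norm_sub_le _ _).trans ?_
  have h1 : ‖(s : ℂ) * Real.sin (s * (b - x)) * f a + s * Real.sin (s * (x - a)) * f b‖ ≤
      s * ‖f a‖ + s * ‖f b‖ := by
    refine (norm_add_le _ _).trans (add_le_add ?_ ?_) <;> rw [mul_assoc, hs'] <;>
      exact mul_le_mul_of_nonneg_left (one _ _) hs.le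
  have h2 : ‖(Real.sin (s * (b - x)) : ℂ) * L + Real.sin (s * (x - a)) * R‖ ≤ D + D :=
    (norm_add_le _ _).trans (add_le_add ((one _ _).trans hL) ((one _ _).trans hR))
  linarith

end IsPrimOn

/-! ### Vertex recursion and the resolvent estimate -/

theorem sq_add_three_le (x y z : ℝ) : (x + y + z) ^ 2 ≤ 3 * (x ^ 2 + y ^ 2 + z ^ 2) := by
  nlinarith [sq_nonneg (x - y), sq_nonneg (y - z), sq_nonneg (x - z)]

/-- Pointwise form of the invertibility of the discrete vertex operator. -/
theorem vertex_sq_le {x y z : ℂ} {s c D η : ℝ} (hs : 0 < s) (hη : 0 < η)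
    (h : ‖s * (x + 2 * y) - 3 * (s * c) * z‖ ≤ D) :
    2 * ‖y‖ ^ 2 - ‖x‖ ^ 2 ≤ (1 + η) * (9 * c ^ 2) * ‖z‖ ^ 2 + (1 + 1 / η) * (D ^ 2 / s ^ 2) := by
  have h1 : ‖x + 2 * y‖ ≤ 3 * |c| * ‖z‖ + D / s := by
    have h2 : s * ‖x + 2 * y‖ ≤ s * (3 * |c| * ‖z‖) + D := by
      have e1 : ‖(s : ℂ) * (x + 2 * y)‖ = s * ‖x + 2 * y‖ := by
        rw [norm_mul, Complex.norm_real, Real.norm_of_nonneg hs.le]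
      have e2 : ‖3 * ((s : ℂ) * c) * z‖ = s * (3 * |c| * ‖z‖) := by
        simp only [norm_mul, Complex.norm_real, Real.norm_of_nonneg hs.le, Real.norm_eq_abs,
          Complex.norm_ofNat]
        ring
      rw [← e1, ← e2]
      linarith [norm_sub_norm_le ((s : ℂ) * (x + 2 * y)) (3 * ((s : ℂ) * c) * z)]
    rw [← mul_le_mul_iff_right₀ hs]
    refine h2.trans (le_of_eq ?_)
    field_simp
  have h3 : 2 * ‖y‖ ≤ ‖x + 2 * y‖ + ‖x‖ := by
    have := norm_sub_le (x + 2 * y) x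
    rwa [add_sub_cancel_left, norm_mul, Complex.norm_ofNat] at this
  have h4 : ‖x‖ ≤ ‖x + 2 * y‖ + 2 * ‖y‖ := by
    have := norm_sub_le (x + 2 * y) (2 * y)
    rwa [add_sub_cancel_right, norm_mul, Complex.norm_ofNat] at this
  -- For consecutive terms x and y of an ℓ² sequence, the left side sums to exactly one copy of the
  -- squared norm. The inequality is (2‖y‖ - ‖x‖)² = 2‖y‖² - ‖x‖² + 2(‖y‖ - ‖x‖)².
  have h5 : 2 * ‖y‖ ^ 2 - ‖x‖ ^ 2 ≤ ‖x + 2 * y‖ ^ 2 := by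
    have h6 : (2 * ‖y‖ - ‖x‖) ^ 2 ≤ ‖x + 2 * y‖ ^ 2 := by
      apply sq_le_sq'
      · linarith
      · linarith
    nlinarith [sq_nonneg (‖y‖ - ‖x‖)]
  have h7 : ‖x + 2 * y‖ ^ 2 ≤ (3 * |c| * ‖z‖ + D / s) ^ 2 :=
    pow_le_pow_left₀ (norm_nonneg _) h1 2
  have h8 : ∀ p q : ℝ, (p + q) ^ 2 ≤ (1 + η) * p ^ 2 + (1 + 1 / η) * q ^ 2 := by
    intro p q
    have : 0 ≤ (η * p - q) ^ 2 / η := by positivity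
    have e : (1 + η) * p ^ 2 + (1 + 1 / η) * q ^ 2 - (p + q) ^ 2 = (η * p - q) ^ 2 / η := by
      field_simp
      ring
    linarith
  refine (h5.trans (h7.trans (h8 _ _))).trans (le_of_eq ?_)
  rw [mul_pow, mul_pow, sq_abs, div_pow]
  ring

theorem HasSum.cells {F : ℤ × SignType → ℝ} {S : ℝ} (h : HasSum F S) :
    HasSum (fun n => F (n, 0) + F (n, 1) + F (n, -1)) S := by
  have := h.prod_fiberwise fun n => hasSum_fintype _
  exact this.congr_fun fun n => (sum_signType fun j => F (n, j)).symm

theorem HasSum.shift_int {F : ℤ → ℝ} {S : ℝ} (h : HasSum F S) :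
    HasSum (fun n => F (n + 1)) S :=
  (Equiv.addRight (1 : ℤ)).hasSum_iff.2 h

theorem le_of_helmholtz_sq {s X A B D Q : ℝ} (hs : 0 < s) (hD : D ^ 2 ≤ Q)
    (h : s ^ 2 * (8 / 9) * X ≤ 3 * ((s * A) ^ 2 + (s * B) ^ 2 + (2 * D) ^ 2)) :
    X ≤ 4 * (A ^ 2 + B ^ 2) + 16 / s ^ 2 * Q := by
  have h5 : s ^ 2 * (16 / s ^ 2 * Q) = 16 * Q := by field_simp
  have hs2 : 0 < s ^ 2 := by positivity
  rw [← mul_le_mul_iff_right₀ hs2, mul_add, h5]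
  have hA : 0 ≤ (s * A) ^ 2 := sq_nonneg _
  have hB : 0 ≤ (s * B) ^ 2 := sq_nonneg _
  have hQ : 0 ≤ Q := (sq_nonneg D).trans hD
  rw [show s ^ 2 * (4 * (A ^ 2 + B ^ 2)) = 4 * ((s * A) ^ 2 + (s * B) ^ 2) by ring]
  rw [show (2 * D) ^ 2 = 4 * D ^ 2 by ring] at h
  linarith

/-- The constant in the resolvent estimate. -/
def gapConst (ε : ℝ) : ℝ :=
  Real.pi * (216 / ε * (1 + 2 / ε) * Real.pi + 16 * Real.pi)

set_option maxHeartbeats 1000000 in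
/-- If `(3 cos(πs))² ≤ 1 - ε`, then `s²` is in a spectral gap of the Laplacian, with a quantitative
resolvent estimate. -/
theorem IsLaplacian.sq_norm_le {u w : L2} (h : IsLaplacian u w) {s ε : ℝ} (hs : 0 < s)
    (hε : 0 < ε) (hc : 9 * Real.cos (s * Real.pi) ^ 2 ≤ 1 - ε) :
    s ^ 2 * ‖u‖ ^ 2 ≤ gapConst ε * ‖w + (s : ℂ) ^ 2 • u‖ ^ 2 := by
  obtain ⟨v, ⟨f, hf, hp, hcont⟩, g, hg, hgw, hflux⟩ := h
  set F := w + (s : ℂ) ^ 2 • u with hF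
  set c := Real.cos (s * Real.pi) with hcdef
  have hfg : ∀ i : ℤ × SignType, IsPrimOn (edgeStart i.1 i.2) (edgeStart i.1 i.2 + Real.pi)
      (fun x => f (edgeMap i x)) (fun x => g (edgeMap i x)) := fun i =>
    (hp.isPrimOn i).congr_deriv (onEdge_congr hg i).symm
  set D : ℤ × SignType → ℝ := fun i => ∫ x, ‖onEdge F i x‖ ∂edgeMeasure i with hD
  have hDeq : ∀ i : ℤ × SignType, ∫ z in Set.Icc (edgeStart i.1 i.2)
      (edgeStart i.1 i.2 + Real.pi), ‖onEdge w i z + (s : ℂ) ^ 2 * f (edgeMap i z)‖ = D i := by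
    intro i
    refine integral_congr_ae ?_
    change ∀ᵐ x ∂edgeMeasure i, _
    filter_upwards [onEdge_add w ((s : ℂ) ^ 2 • u) i, onEdge_smul ((s : ℂ) ^ 2) u i,
      onEdge_congr hf i] with x h1 h2 h3
    rw [hF, h1, Pi.add_apply, h2, Pi.smul_apply, smul_eq_mul, ← h3]
  set Q : ℤ × SignType → ℝ := fun i => Real.pi * edgeSq F i with hQ
  have hQ0 : ∀ i, 0 ≤ Q i := fun i => mul_nonneg Real.pi_pos.le (edgeSq_nonneg F i)
  have hDQ : ∀ i, D i ^ 2 ≤ Q i := sq_integral_norm_onEdge_le F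
  have hQsum : HasSum Q (Real.pi * ‖F‖ ^ 2) := (hasSum_edgeSq F).mul_left _
  have hQcell := HasSum.cells hQsum
  set W : ℤ → ℂ := fun n => leftEnd f (n, 0) with hW
  set V : ℤ → ℂ := fun n => rightEnd f (n, 0) with hV
  have hleft : ∀ i, ‖rightEnd g i * Real.sin (s * Real.pi) - rightEnd f i * (s * c : ℝ) +
      leftEnd f i * s‖ ≤ D i := by
    intro i
    have := (hfg i).norm_left_le (s := s) (hgw.isPrimOn i) (right_mem_edge i)
    rw [hDeq i, add_sub_cancel_left] at this
    exact this
  have hright : ∀ i, ‖rightEnd f i * s - leftEnd g i * Real.sin (s * Real.pi) -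
      leftEnd f i * (s * c : ℝ)‖ ≤ D i := by
    intro i
    have := (hfg i).norm_right_le (s := s) (hgw.isPrimOn i) (left_mem_edge i)
    rw [hDeq i, add_sub_cancel_left] at this
    exact this
  -- The three edge relations at the vertex 2πn + π are added. The derivatives there carry the
  -- common factor sin(sπ) and cancel by Kirchhoff's condition.
  have hv1 : ∀ n, ‖s * (W n + 2 * W (n + 1)) - 3 * ((s : ℂ) * c) * V n‖ ≤
      D (n, 0) + D (n, 1) + D (n, -1) := by
    intro n
    obtain ⟨c1, c2, c3, c4⟩ := hcont.ends n
    have e0 := hleft (n, 0)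
    have e1 := hright (n, 1)
    have e2 := hright (n, -1)
    rw [(hflux.ends n).1] at e0
    rw [c1, c3] at e1
    rw [c2, c4] at e2
    refine le_trans (le_of_eq (congrArg _ ?_))
      ((norm_add₃_le).trans (add_le_add (add_le_add e0 e1) e2))
    simp only [hW, hV]
    push_cast
    ring
  have hv2 : ∀ n, ‖s * (V (n + 1) + 2 * V n) - 3 * ((s : ℂ) * c) * W (n + 1)‖ ≤
      D (n + 1, 0) + D (n, 1) + D (n, -1) := by
    intro n
    obtain ⟨c1, c2, c3, c4⟩ := hcont.ends n
    have e0 := hright (n + 1, 0)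
    have e1 := hleft (n, 1)
    have e2 := hleft (n, -1)
    rw [(hflux.ends n).2] at e0
    rw [c1, c3] at e1
    rw [c2, c4] at e2
    refine le_trans (le_of_eq (congrArg _ ?_))
      ((norm_add₃_le).trans (add_le_add (add_le_add e0 e1) e2))
    simp only [hW, hV]
    push_cast
    ring
  have hinj : Function.Injective fun n : ℤ => (n, (0 : SignType)) := fun a b h => by simpa using h
  have hleftSq : Summable fun i => ‖leftEnd f i‖ ^ 2 :=
    summable_sq_of_edgewisePrimitive hf hp left_mem_edge
  have hrightSq : Summable fun i => ‖rightEnd f i‖ ^ 2 :=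
    summable_sq_of_edgewisePrimitive hf hp right_mem_edge
  obtain ⟨SW, hSW⟩ : Summable fun n => ‖W n‖ ^ 2 := hleftSq.comp_injective hinj
  obtain ⟨SV, hSV⟩ : Summable fun n => ‖V n‖ ^ 2 := hrightSq.comp_injective hinj
  have hSW0 : 0 ≤ SW := hSW.nonneg fun _ => by positivity
  have hSV0 : 0 ≤ SV := hSV.nonneg fun _ => by positivity
  -- Weight of the error terms when `vertex_sq_le` is applied with η = ε / 2, which still leaves the
  -- contraction factor (1 + ε/2)(1 - ε) ≤ 1 - ε/2.
  set M := (1 + 1 / (ε / 2)) / s ^ 2 with hM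
  have hM0 : 0 ≤ M := by positivity
  have hb1 : ∀ n, 2 * ‖W (n + 1)‖ ^ 2 - ‖W n‖ ^ 2 ≤ (1 + ε / 2) * (9 * c ^ 2) * ‖V n‖ ^ 2 +
      M * (3 * (Q (n, 0) + Q (n, 1) + Q (n, -1))) := by
    intro n
    refine (vertex_sq_le hs (half_pos hε) (hv1 n)).trans (add_le_add le_rfl ?_)
    rw [hM, div_mul_eq_mul_div, mul_div_assoc]
    gcongr
    refine (sq_add_three_le _ _ _).trans ?_
    linarith [hDQ (n, 0), hDQ (n, 1), hDQ (n, -1)]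
  have hb2 : ∀ n, 2 * ‖V n‖ ^ 2 - ‖V (n + 1)‖ ^ 2 ≤
      (1 + ε / 2) * (9 * c ^ 2) * ‖W (n + 1)‖ ^ 2 +
      M * (3 * ((Q (n + 1, 0) + Q (n + 1, 1) + Q (n + 1, -1)) +
        (Q (n, 0) + Q (n, 1) + Q (n, -1)))) := by
    intro n
    refine (vertex_sq_le hs (half_pos hε) (hv2 n)).trans (add_le_add le_rfl ?_)
    rw [hM, div_mul_eq_mul_div, mul_div_assoc]
    gcongr
    refine (sq_add_three_le _ _ _).trans ?_
    linarith [hDQ (n + 1, 0), hDQ (n, 1), hDQ (n, -1), hQ0 (n, 0), hQ0 (n + 1, 1),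
      hQ0 (n + 1, -1)]
  have hs1 := hasSum_le hb1 (((HasSum.shift_int hSW).mul_left 2).sub hSW)
    ((hSV.mul_left _).add ((hQcell.mul_left 3).mul_left M))
  have hs2 := hasSum_le hb2 ((hSV.mul_left 2).sub (HasSum.shift_int hSV))
    (((HasSum.shift_int hSW).mul_left _).add
      ((((HasSum.shift_int hQcell).add hQcell).mul_left 3).mul_left M))
  have hcontr : (1 + ε / 2) * (9 * c ^ 2) ≤ 1 - ε / 2 := by nlinarith
  -- Adding the two summed recursions absorbs (1 - ε/2)(SW + SV) on the left. The factor 9 is 3 + 6,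
  -- since the second recursion bounds its error by two full cells.
  have hS : SW + SV ≤ 2 / ε * (9 * M * (Real.pi * ‖F‖ ^ 2)) := by
    have h1 := mul_le_mul_of_nonneg_right hcontr hSV0
    have h2 := mul_le_mul_of_nonneg_right hcontr hSW0
    have h3 : ε / 2 * (SW + SV) ≤ 9 * M * (Real.pi * ‖F‖ ^ 2) := by linarith
    have h4 := mul_le_mul_of_nonneg_left h3 (show 0 ≤ 2 / ε by positivity)
    refine le_trans (le_of_eq ?_) h4
    field_simp
  -- In a gap s² also stays away from the Dirichlet eigenvalues of an edge, so the vertex values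
  -- control the function on the edges.
  have hsin : 8 / 9 ≤ Real.sin (s * Real.pi) ^ 2 := by
    have := Real.sin_sq_add_cos_sq (s * Real.pi)
    linarith
  have hends : ∀ i, edgeSq u i ≤
      Real.pi * (4 * (‖leftEnd f i‖ ^ 2 + ‖rightEnd f i‖ ^ 2) + 16 / s ^ 2 * Q i) := by
    intro i
    have hpt : ∀ x ∈ edge i.1 i.2, ‖f (edgeMap i x)‖ ^ 2 ≤
        4 * (‖leftEnd f i‖ ^ 2 + ‖rightEnd f i‖ ^ 2) + 16 / s ^ 2 * Q i := by
      intro x hx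
      have h1 := (hfg i).norm_le_of_ends (hgw.isPrimOn i) hs hx
      rw [hDeq i, add_sub_cancel_left] at h1
      change _ ≤ s * ‖leftEnd f i‖ + s * ‖rightEnd f i‖ + 2 * D i at h1
      have h2 := pow_le_pow_left₀ (by positivity) h1 2
      rw [mul_pow, mul_pow, sq_abs] at h2
      have h3 := h2.trans (sq_add_three_le _ _ _)
      have h4 : s ^ 2 * (8 / 9) * ‖f (edgeMap i x)‖ ^ 2 ≤
          s ^ 2 * Real.sin (s * Real.pi) ^ 2 * ‖f (edgeMap i x)‖ ^ 2 := by gcongr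
      exact le_of_helmholtz_sq hs (hDQ i) (h4.trans h3)
    rw [edgeSq_eq hf]
    have hi : Integrable (fun x => ‖f (edgeMap i x)‖ ^ 2) (edgeMeasure i) :=
      (((hfg i).continuousOn (lt_edgeEnd i).le).norm.pow 2).integrableOn_Icc
    refine (setIntegral_mono_on hi (integrable_const (μ := edgeMeasure i) _) measurableSet_Icc hpt).trans ?_
    rw [integral_const, measureReal_restrict_apply_univ, edge,
      Real.volume_real_Icc_of_le (lt_edgeEnd i).le, add_sub_cancel_left, smul_eq_mul]
  -- Every vertex has three incident edges, so the sum over edge ends is 3(SV + SW).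
  have hcellEnds : HasSum (fun n => 3 * ‖V n‖ ^ 2 + (‖W n‖ ^ 2 + 2 * ‖W (n + 1)‖ ^ 2))
      (∑' i, (‖leftEnd f i‖ ^ 2 + ‖rightEnd f i‖ ^ 2)) := by
    refine (HasSum.cells (hleftSq.add hrightSq).hasSum).congr_fun fun n => ?_
    obtain ⟨c1, c2, c3, c4⟩ := hcont.ends n
    simp only [c1, c2, c3, c4, hW, hV]
    ring
  have htot := hcellEnds.unique ((hSV.mul_left 3).add
    (hSW.add ((HasSum.shift_int hSW).mul_left 2)))
  have hu := hasSum_le hends (hasSum_edgeSq u)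
    ((((hleftSq.add hrightSq).hasSum.mul_left 4).add (hQsum.mul_left (16 / s ^ 2))).mul_left
      Real.pi)
  rw [htot] at hu
  have hfin : ‖u‖ ^ 2 ≤ Real.pi * (12 * (2 / ε * (9 * M * (Real.pi * ‖F‖ ^ 2))) +
      16 / s ^ 2 * (Real.pi * ‖F‖ ^ 2)) := by
    refine hu.trans (mul_le_mul_of_nonneg_left ?_ Real.pi_pos.le)
    linarith
  refine (mul_le_mul_of_nonneg_left hfin (sq_nonneg s)).trans (le_of_eq ?_)
  rw [hM, gapConst]
  field_simp
  ring

/-! ### Square root of the modulus of a self-adjoint operator -/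

section SqrtAbs

variable {E : Type*} [NormedAddCommGroup E] [InnerProductSpace ℂ E] [CompleteSpace E]

/-- The operator `|R|^{1/2}`. -/
def sqrtAbs (R : E →L[ℂ] E) : E →L[ℂ] E := cfc (fun x : ℝ => Real.sqrt |x|) R

variable {R : E →L[ℂ] E}

theorem isSelfAdjoint_sqrtAbs (R : E →L[ℂ] E) : IsSelfAdjoint (sqrtAbs R) := cfc_predicate _ _

theorem inner_sqrtAbs_left (R : E →L[ℂ] E) (x y : E) :
    inner ℂ (sqrtAbs R x) y = inner ℂ x (sqrtAbs R y) :=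
  (isSelfAdjoint_sqrtAbs R).isSymmetric x y

theorem sqrtAbs_apply_comm (hR : IsSelfAdjoint R) (x : E) :
    sqrtAbs R (R x) = R (sqrtAbs R x) := by
  have h := cfc_commute_cfc (fun x : ℝ => Real.sqrt |x|) (fun x : ℝ => x) R
  rw [cfc_id' ℝ R] at h
  exact congrArg (fun A : E →L[ℂ] E => A x) h.eq

/-- The square of `sqrtAbs R` is |R|, and |R|² = R². -/
theorem norm_sqrtAbs_sqrtAbs (hR : IsSelfAdjoint R) (x : E) :
    ‖sqrtAbs R (sqrtAbs R x)‖ = ‖R x‖ := by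
  have h : sqrtAbs R * sqrtAbs R * (sqrtAbs R * sqrtAbs R) = R * R := by
    have e : sqrtAbs R * sqrtAbs R = cfc (fun x : ℝ => |x|) R := by
      rw [sqrtAbs, ← cfc_mul _ _ R]
      simp only [Real.mul_self_sqrt (abs_nonneg _)]
    rw [e, ← cfc_mul _ _ R]
    simp only [abs_mul_abs_self]
    rw [cfc_mul _ _ R, cfc_id' ℝ R]
  have h2 : inner ℂ (sqrtAbs R (sqrtAbs R x)) (sqrtAbs R (sqrtAbs R x)) = inner ℂ (R x) (R x) := by
    have e1 : inner ℂ (R x) (R x) = inner ℂ x ((R * R) x) := hR.isSymmetric x (R x)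
    rw [e1, ← h, inner_sqrtAbs_left, inner_sqrtAbs_left]
    rfl
  rw [inner_self_eq_norm_sq_to_K, inner_self_eq_norm_sq_to_K] at h2
  have h3 : ‖sqrtAbs R (sqrtAbs R x)‖ ^ 2 = ‖R x‖ ^ 2 := by exact_mod_cast h2
  exact (pow_left_inj₀ (norm_nonneg _) (norm_nonneg _) two_ne_zero).1 h3

theorem norm_sqrtAbs_sq_le (hR : IsSelfAdjoint R) (x : E) :
    ‖sqrtAbs R x‖ ^ 2 ≤ ‖R‖ * ‖x‖ ^ 2 := by
  have h1 : ‖sqrtAbs R x‖ ^ 2 = ‖inner ℂ x (sqrtAbs R (sqrtAbs R x))‖ := by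
    rw [← inner_sqrtAbs_left, inner_self_eq_norm_sq_to_K, norm_pow]
    simp
  rw [h1]
  refine (norm_inner_le_norm _ _).trans ?_
  rw [norm_sqrtAbs_sqrtAbs hR]
  nlinarith [R.le_opNorm x, norm_nonneg x]

theorem norm_inner_sqrtAbs_le (hR : IsSelfAdjoint R) (x : E) :
    ‖inner ℂ (sqrtAbs R x) (R (sqrtAbs R x))‖ ≤ ‖R x‖ ^ 2 := by
  rw [← sqrtAbs_apply_comm hR, ← inner_sqrtAbs_left]
  refine (norm_inner_le_norm _ _).trans ?_
  rw [norm_sqrtAbs_sqrtAbs hR, sq]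

/-- The orthogonal complement of the range of a self-adjoint operator is its kernel, so injectivity
makes the range dense. -/
theorem exists_tendsto_of_injective (hR : IsSelfAdjoint R) (hinj : ∀ x, R x = 0 → x = 0) (w : E) :
    ∃ y : ℕ → E, Filter.Tendsto (fun n => R (y n)) Filter.atTop (nhds w) := by
  have hker : R.rangeᗮ = ⊥ := by
    rw [ContinuousLinearMap.IsStarNormal.orthogonal_range hR.isStarNormal]
    exact (Submodule.eq_bot_iff _).2 fun x hx => hinj x hx
  have hdense : R.range.topologicalClosure = ⊤ :=
    Submodule.topologicalClosure_eq_top_iff.2 hker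
  have hw : w ∈ closure (R.range : Set E) := by
    rw [← Submodule.topologicalClosure_coe, hdense]
    trivial
  obtain ⟨z, hz, hlim⟩ := mem_closure_iff_seq_limit.1 hw
  choose y hy using hz
  refine ⟨y, hlim.congr fun n => ?_⟩
  exact (hy n).symm

end SqrtAbs

/-! ### The operators `L_k` -/

theorem IsH1cDeriv.sub {u v u' v' : L2} (h : IsH1cDeriv u v) (h' : IsH1cDeriv u' v') :
    IsH1cDeriv (u - u') (v - v') := by
  obtain ⟨f, hf, hp, hc⟩ := h
  obtain ⟨f', hf', hp', hc'⟩ := h'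
  refine ⟨f - f', (hf.sub hf').trans (Lp.coeFn_sub u u').symm, fun n j x hx => ?_, fun n => ?_⟩
  · have h1 := ((hp.isPrimOn (n, j)).sub (hp'.isPrimOn (n, j))).congr_deriv
      (onEdge_sub v v' (n, j)).symm
    exact h1.eq_add x hx
  · simp only [Pi.sub_apply]
    obtain ⟨⟨h1, h2⟩, h3, h4⟩ := hc n
    obtain ⟨⟨h1', h2'⟩, h3', h4'⟩ := hc' n
    exact ⟨⟨by rw [h1, h1'], by rw [h2, h2']⟩, by rw [h3, h3'], by rw [h4, h4']⟩

section Resolvent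

variable {T α : ℝ} {k : ℤ} {R : L2symm →L[ℂ] L2symm}

theorem opL_apply (hR : IsResolventAt (OpL T α k) 0 R) (f : L2symm) : OpL T α k (R f) f := by
  simpa using (hR f (R f)).1 rfl

theorem inner_resolvent_comm (hR : IsResolventAt (OpL T α k) 0 R) (f g : L2symm) :
    inner ℂ (R f) g = inner ℂ f (R g) := by
  obtain ⟨w, hw, hfw⟩ := opL_apply hR f
  obtain ⟨w', hw', hgw⟩ := opL_apply hR g
  rw [Submodule.coe_inner, Submodule.coe_inner, hfw, hgw, inner_add_left, inner_add_right,
    inner_neg_left, inner_neg_right, inner_smul_left, inner_smul_right, hw.inner_comm hw',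
    Complex.conj_ofReal]

theorem isSelfAdjoint_resolvent (hR : IsResolventAt (OpL T α k) 0 R) : IsSelfAdjoint R :=
  ContinuousLinearMap.isSelfAdjoint_iff_isSymmetric.2 (inner_resolvent_comm hR)

theorem eq_zero_of_resolvent_eq_zero (hR : IsResolventAt (OpL T α k) 0 R) (f : L2symm)
    (hf : R f = 0) : f = 0 := by
  obtain ⟨w, hw, hfw⟩ := opL_apply hR f
  rw [hf] at hw hfw
  have hw0 : w = 0 := IsLaplacian.eq_zero hw
  rw [hw0] at hfw
  refine Subtype.ext (hfw.trans ?_)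
  simp

theorem opL_norm_h1Deriv_sq {u f : L2symm} (h : OpL T α k u f) :
    ‖h1Deriv u‖ ^ 2 = (inner ℂ u f : ℂ).re + ((freq T) ^ 2 * k ^ 2 - α) * ‖u‖ ^ 2 := by
  obtain ⟨w, hw, hfw⟩ := h
  rw [norm_h1Deriv_sq hw, Submodule.coe_inner, hfw, inner_add_right, inner_neg_right,
    inner_smul_right, inner_self_eq_norm_sq_to_K, Complex.add_re, Complex.neg_re]
  have e : ((-(freq T) ^ 2 * (k : ℝ) ^ 2 + α : ℝ) : ℂ) * ((‖(u : L2)‖ : ℂ) ^ 2) =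
    (((-(freq T) ^ 2 * (k : ℝ) ^ 2 + α) * ‖(u : L2)‖ ^ 2 : ℝ) : ℂ) := by push_cast; ring
  simp only [Complex.coe_algebraMap, e, Complex.ofReal_re, Submodule.coe_norm]
  ring

/-- The form estimate on a core: |R|^{1/2} R y = R(|R|^{1/2} y) lies in the domain of L_k, so
Green's identity applies, and L_k maps it to |R|^{1/2} y. -/
theorem norm_h1Deriv_resolvent_le (hα : 0 ≤ α) (hR : IsResolventAt (OpL T α k) 0 R)
    (y : L2symm) :
    ‖h1Deriv (sqrtAbs R (R y) : L2symm)‖ ^ 2 ≤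
      (1 + (freq T) ^ 2 * k ^ 2 * ‖R‖) * ‖R y‖ ^ 2 := by
  have hsa := isSelfAdjoint_resolvent hR
  have h1 := norm_sqrtAbs_sq_le hsa (R y)
  rw [sqrtAbs_apply_comm hsa] at h1 ⊢
  rw [opL_norm_h1Deriv_sq (opL_apply hR (sqrtAbs R y))]
  have h2 : (inner ℂ (R (sqrtAbs R y)) (sqrtAbs R y) : ℂ).re ≤ ‖R y‖ ^ 2 := by
    rw [inner_resolvent_comm hR]
    exact (Complex.re_le_norm _).trans (norm_inner_sqrtAbs_le hsa y)
  have h3 : 0 ≤ α * ‖R (sqrtAbs R y)‖ ^ 2 := by positivity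
  have h4 := mul_le_mul_of_nonneg_left h1 (show 0 ≤ (freq T) ^ 2 * (k : ℝ) ^ 2 by positivity)
  linarith

/-- The derivative on the form domain of `|L_k|`. -/
theorem norm_h1Deriv_sqrtAbs_le (hα : 0 ≤ α) (hR : IsResolventAt (OpL T α k) 0 R)
    {v w : L2symm} (hv : MemH1c v) (hvw : sqrtAbs R w = v) :
    ‖h1Deriv v‖ ^ 2 ≤ (1 + (freq T) ^ 2 * k ^ 2 * ‖R‖) * ‖w‖ ^ 2 := by
  have hsa := isSelfAdjoint_resolvent hR
  set M := 1 + (freq T) ^ 2 * k ^ 2 * ‖R‖ with hM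
  have hM0 : 0 ≤ M := by positivity
  obtain ⟨y, hy⟩ := exists_tendsto_of_injective hsa (eq_zero_of_resolvent_eq_zero hR) w
  set u : ℕ → L2symm := fun n => sqrtAbs R (R (y n)) with hu
  have hder : ∀ z : L2symm, IsH1cDeriv (sqrtAbs R (R z) : L2symm)
      (h1Deriv (sqrtAbs R (R z) : L2symm)) := by
    intro z
    rw [sqrtAbs_apply_comm hsa]
    obtain ⟨w', hw', -⟩ := opL_apply hR (sqrtAbs R z)
    exact hw'.isH1cDeriv
  have hulim : Filter.Tendsto (fun n => (u n : L2)) Filter.atTop (nhds (v : L2)) := by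
    rw [← hvw]
    exact (continuous_subtype_val.comp (sqrtAbs R).continuous).continuousAt.tendsto.comp hy
  -- The core estimate applied to differences makes the derivatives Cauchy; closedness of the
  -- derivative then identifies their limit with the derivative of v.
  have hcauchy : CauchySeq fun n => h1Deriv (u n) := by
    have hdiff : ∀ n m, ‖h1Deriv (u n) - h1Deriv (u m)‖ ≤
        Real.sqrt M * ‖R (y n) - R (y m)‖ := by
      intro n m
      have h1 := norm_h1Deriv_resolvent_le hα hR (y n - y m)
      have h2 : h1Deriv (sqrtAbs R (R (y n - y m)) : L2symm) =
          h1Deriv (u n) - h1Deriv (u m) := by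
        refine h1Deriv_eq ?_
        rw [map_sub, map_sub]
        exact (hder (y n)).sub (hder (y m))
      rw [h2, map_sub] at h1
      refine (abs_le_of_sq_le_sq' (a := ‖h1Deriv (u n) - h1Deriv (u m)‖) ?_ (by positivity)).2
      rw [mul_pow, Real.sq_sqrt hM0]
      exact h1
    have hcw := hy.cauchySeq
    rw [Metric.cauchySeq_iff'] at hcw ⊢
    intro δ hδ
    obtain ⟨N, hN⟩ := hcw (δ / (Real.sqrt M + 1)) (by positivity)
    refine ⟨N, fun n hn => ?_⟩
    have h1 := hN n hn
    rw [dist_eq_norm] at h1 ⊢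
    refine (hdiff n N).trans_lt ?_
    have hsq := Real.sqrt_nonneg M
    rw [lt_div_iff₀ (by positivity)] at h1
    nlinarith [norm_nonneg (R (y n) - R (y N))]
  obtain ⟨g, hg⟩ := cauchySeq_tendsto_of_complete hcauchy
  obtain ⟨v', hv'⟩ := hv
  have heq : v' = g := hv'.eq_of_tendsto (fun n => hder (y n)) hulim hg
  rw [h1Deriv_eq hv', heq]
  exact le_of_tendsto_of_tendsto' (hg.norm.pow 2) ((hy.norm.pow 2).const_mul M) fun n =>
    norm_h1Deriv_resolvent_le hα hR (y n)

theorem resolvent_norm_le (hR : IsResolventAt (OpL T α k) 0 R) {s ε : ℝ} (hs : 0 < s)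
    (hs2 : s ^ 2 = (freq T) ^ 2 * k ^ 2 - α) (hε : 0 < ε)
    (hc : 9 * Real.cos (s * Real.pi) ^ 2 ≤ 1 - ε) :
    ‖R‖ ≤ Real.sqrt (gapConst ε) / s := by
  refine R.opNorm_le_bound (by positivity) fun f => ?_
  obtain ⟨w, hw, hfw⟩ := opL_apply hR f
  have h := hw.sq_norm_le hs hε hc
  have e : w + (s : ℂ) ^ 2 • (R f : L2) = -(f : L2) := by
    have e2 : ((-(freq T) ^ 2 * (k : ℝ) ^ 2 + α : ℝ) : ℂ) = -(s : ℂ) ^ 2 := by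
      rw [← Complex.ofReal_pow, hs2]
      push_cast
      ring
    rw [hfw, e2, neg_smul]
    abel
  have hK : 0 ≤ gapConst ε := by
    have := Real.pi_pos
    rw [gapConst]
    positivity
  rw [e, norm_neg] at h
  rw [div_mul_eq_mul_div, le_div_iff₀ hs]
  refine (abs_le_of_sq_le_sq' (a := ‖R f‖ * s) ?_ (by positivity)).2
  rw [mul_pow, mul_pow, Real.sq_sqrt hK, mul_comm]
  exact h

end Resolvent

theorem ne_zero_of_mem_oddMultiples {κ : ℤ} (hκ : Odd κ) {k : ℤ} (hk : k ∈ oddMultiples κ) :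
    k ≠ 0 := by
  obtain ⟨m, hm, rfl⟩ := hk
  intro h
  have := hκ.mul hm
  rw [h] at this
  exact absurd this (by decide)

theorem one_le_abs_of_mem_oddMultiples {κ : ℤ} (hκ : Odd κ) {k : ℤ} (hk : k ∈ oddMultiples κ) :
    1 ≤ |(k : ℝ)| := by
  exact_mod_cast Int.one_le_abs (ne_zero_of_mem_oddMultiples hκ hk)

theorem SpecCondition.isResolventAt {T α : ℝ} {κ : ℤ} (h : SpecCondition T α κ) {k : ℤ}
    (hk : k ∈ oddMultiples κ) : IsResolventAt (OpL T α k) 0 (opInverse (OpL T α k)) := by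
  have h1 : ∃ R : L2symm →L[ℂ] L2symm, IsResolventAt (OpL T α k) 0 R := by
    by_contra h2
    exact h (subset_closure (Set.mem_iUnion₂.2 ⟨k, hk, h2⟩))
  rw [opInverse, dif_pos h1]
  exact h1.choose_spec

/-- The weights 1/|k| and |k| are matched to ‖R‖ ≤ B/|k|: the term ω²k²‖R‖ in the derivative
estimate grows only like |k|, and ‖v‖² gains a factor 1/|k|. -/
theorem calHEmbedsIntoH_of_resolvent_le {T α : ℝ} (hα : 0 ≤ α) {κ : ℤ} (hκ : Odd κ)
    (hspec : SpecCondition T α κ) {B : ℝ}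
    (hB : ∀ k ∈ oddMultiples κ, |(k : ℝ)| * ‖opInverse (OpL T α k)‖ ≤ B) :
    CalHEmbedsIntoH T α κ := by
  set C := 1 + (freq T) ^ 2 * |B| + |B| with hC
  have hC0 : 0 ≤ C := by positivity
  have hterm : ∀ u : ℤ → L2symm, Admissible κ u → ∀ k : oddMultiples κ,
      ENNReal.ofReal (1 / |((k : ℤ) : ℝ)| * ‖h1Deriv (u k)‖ ^ 2 + |((k : ℤ) : ℝ)| * ‖u k‖ ^ 2) ≤
        ENNReal.ofReal C * absForm (OpL T α k) (u k) := by
    intro u hu k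
    have hR := hspec.isResolventAt k.2
    have hk1 := one_le_abs_of_mem_oddMultiples hκ k.2
    set R := opInverse (OpL T α k) with hRdef
    have hk0 : 0 < |((k : ℤ) : ℝ)| := by linarith
    -- It suffices to estimate against each preimage w of u k under |R|^{1/2}; without a preimage
    -- the right side is ∞.
    rw [absForm, ENNReal.mul_iInf_of_ne (by positivity) ENNReal.ofReal_ne_top]
    refine le_iInf fun w => ?_
    rw [ENNReal.mul_iInf_of_ne (by positivity) ENNReal.ofReal_ne_top]
    refine le_iInf fun hw => ?_
    rw [← ENNReal.ofReal_mul hC0]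
    refine ENNReal.ofReal_le_ofReal ?_
    have h1 := norm_h1Deriv_sqrtAbs_le hα hR (hu.2 k k.2).1 hw
    have h2 := norm_sqrtAbs_sq_le (isSelfAdjoint_resolvent hR) w
    change sqrtAbs R w = _ at hw
    rw [hw] at h2
    have hBk := (hB k k.2).trans (le_abs_self B)
    have e : (freq T) ^ 2 * ((k : ℤ) : ℝ) ^ 2 * ‖R‖ =
        (freq T) ^ 2 * |((k : ℤ) : ℝ)| * (|((k : ℤ) : ℝ)| * ‖R‖) := by
      rw [← sq_abs ((k : ℤ) : ℝ)]
      ring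
    rw [e] at h1
    have h3 : 1 / |((k : ℤ) : ℝ)| * ‖h1Deriv (u k)‖ ^ 2 ≤ (1 + (freq T) ^ 2 * |B|) * ‖w‖ ^ 2 := by
      rw [one_div_mul_eq_div, div_le_iff₀ hk0]
      refine h1.trans ?_
      have h4 : (freq T) ^ 2 * |((k : ℤ) : ℝ)| * (|((k : ℤ) : ℝ)| * ‖R‖) ≤
          (freq T) ^ 2 * |((k : ℤ) : ℝ)| * |B| := by gcongr
      have h5 := mul_le_mul_of_nonneg_right h4 (sq_nonneg ‖w‖)
      have h6 := mul_le_mul_of_nonneg_right hk1 (sq_nonneg ‖w‖)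
      linarith
    have h7 : |((k : ℤ) : ℝ)| * ‖u k‖ ^ 2 ≤ |B| * ‖w‖ ^ 2 := by
      have h8 := mul_le_mul_of_nonneg_left h2 hk0.le
      have h9 := mul_le_mul_of_nonneg_right hBk (sq_nonneg ‖w‖)
      linarith
    rw [hC]
    linarith
  refine ⟨(C ^ (1 / 2 : ℝ)).toNNReal, fun u hu => ?_⟩
  have hle : hNorm κ u ≤ ((C ^ (1 / 2 : ℝ)).toNNReal : ℝ≥0∞) * calHNorm T α κ u := by
    have h1 := ENNReal.tsum_le_tsum (hterm u hu.1)
    rw [ENNReal.tsum_mul_left] at h1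
    have h2 := ENNReal.rpow_le_rpow h1 (show (0 : ℝ) ≤ 1 / 2 by norm_num)
    rw [ENNReal.mul_rpow_of_nonneg _ _ (by norm_num), ENNReal.ofReal_rpow_of_nonneg hC0
      (by norm_num)] at h2
    exact h2
  exact ⟨⟨hu.1, hle.trans_lt (ENNReal.mul_lt_top ENNReal.coe_lt_top hu.2)⟩, hle⟩

/-! ### Distance of the frequencies to the bands -/

theorem freq_pos (T : ℝ) [hT : Fact (0 < T)] : 0 < freq T := by
  have := hT.out
  have := Real.pi_pos
  rw [freq]
  positivity

/-- The spectral distance of `ω²k² - α` to the bands is bounded below for large `k`. -/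
def CosCondition (T α : ℝ) (κ : ℤ) : Prop :=
  ∃ N : ℕ, ∃ ε > 0, ∀ k ∈ oddMultiples κ, (N : ℝ) < |(k : ℝ)| →
    9 * Real.cos (Real.sqrt ((freq T) ^ 2 * (k : ℝ) ^ 2 - α) * Real.pi) ^ 2 ≤ 1 - ε

theorem CosCondition.exists_resolvent_bound {T : ℝ} [Fact (0 < T)] {α : ℝ} {κ : ℤ}
    (hspec : SpecCondition T α κ) (h : CosCondition T α κ) :
    ∃ B : ℝ, ∀ k ∈ oddMultiples κ, |(k : ℝ)| * ‖opInverse (OpL T α k)‖ ≤ B := by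
  obtain ⟨N, ε, hε, hN⟩ := h
  have hω := freq_pos T
  set ω := freq T with hωdef
  -- Beyond this threshold α ≤ ω²k²/2, so s is at least ω|k|/2 and a bound in 1/s becomes one in
  -- 1/|k|.
  obtain ⟨N₁, hN₁⟩ := exists_nat_gt (2 * α / ω ^ 2)
  set N' : ℕ := max (max N N₁) 1 with hN'
  have h1N' : (1 : ℝ) ≤ N' := by exact_mod_cast le_max_right _ _
  have hNN' : (N : ℝ) ≤ N' := by
    exact_mod_cast (le_max_left N N₁).trans (le_max_left _ _)
  have hN₁N' : (N₁ : ℝ) ≤ N' := by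
    exact_mod_cast (le_max_right N N₁).trans (le_max_left _ _)
  -- The finitely many small k are covered by adding all their terms; indices outside κ ℤ_odd only
  -- add nonnegative terms.
  set S := ∑ k ∈ Finset.Icc (-(N' : ℤ)) N', |(k : ℝ)| * ‖opInverse (OpL T α k)‖ with hS
  have hS0 : 0 ≤ S := Finset.sum_nonneg fun _ _ => by positivity
  set K := Real.sqrt (gapConst ε) * (2 / ω) with hK
  have hK0 : 0 ≤ K := by positivity
  refine ⟨K + S, fun k hk => ?_⟩
  by_cases hkN : |(k : ℝ)| ≤ N'
  · have hmem : k ∈ Finset.Icc (-(N' : ℤ)) N' := by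
      rw [Finset.mem_Icc]
      have : |k| ≤ (N' : ℤ) := by exact_mod_cast hkN
      exact abs_le.1 this
    have := Finset.single_le_sum (f := fun k : ℤ => |(k : ℝ)| * ‖opInverse (OpL T α k)‖)
      (fun _ _ => by positivity) hmem
    exact this.trans (le_add_of_nonneg_left hK0)
  · push Not at hkN
    have hcos := hN k hk (hNN'.trans_lt hkN)
    have hk1 : 1 ≤ |(k : ℝ)| := h1N'.trans hkN.le
    have hksq : 2 * α / ω ^ 2 ≤ (k : ℝ) ^ 2 := by
      rw [← sq_abs (k : ℝ)]
      have : |(k : ℝ)| ≤ |(k : ℝ)| ^ 2 := by nlinarith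
      linarith
    rw [div_le_iff₀ (by positivity)] at hksq
    have hpos : 0 < ω ^ 2 * (k : ℝ) ^ 2 := by
      rw [← sq_abs (k : ℝ)]
      positivity
    set s := Real.sqrt (ω ^ 2 * (k : ℝ) ^ 2 - α) with hs
    have hs2 : s ^ 2 = ω ^ 2 * (k : ℝ) ^ 2 - α := Real.sq_sqrt (by linarith)
    have hlow : ω * |(k : ℝ)| / 2 ≤ s := by
      refine Real.le_sqrt_of_sq_le ?_
      rw [div_pow, mul_pow, sq_abs]
      linarith
    have hs0 : 0 < s := lt_of_lt_of_le (by positivity) hlow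
    have hR := resolvent_norm_le (hspec.isResolventAt hk) hs0 hs2 hε hcos
    refine le_trans ?_ (le_add_of_nonneg_right hS0)
    refine (mul_le_mul_of_nonneg_left hR (abs_nonneg _)).trans ?_
    have hks : |(k : ℝ)| / s ≤ 2 / ω := by
      rw [div_le_div_iff₀ hs0 hω]
      linarith
    rw [hK, mul_div_left_comm]
    exact mul_le_mul_of_nonneg_left hks (Real.sqrt_nonneg _)

/-- Here t = ω|k| is half an odd integer, so cos(πt) = 0, the centre of a gap, and √(t² - α) differs
from t by at most α/t. -/
theorem cosCondition_of_half {T : ℝ} [Fact (0 < T)] {α : ℝ} (hα : 0 ≤ α) {κ : ℤ} (hκ : Odd κ)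
    {k₀ : ℕ} (hk₀ : Odd k₀) (hfreq : freq T = k₀ / 2) : CosCondition T α κ := by
  have hω := freq_pos T
  have hπ := Real.pi_pos
  -- The first bound gives |cos(πs)| ≤ πα/t ≤ 1/6, hence 9 cos²(πs) ≤ 1/4; the second makes the
  -- radicand nonnegative.
  obtain ⟨N, hN⟩ := exists_nat_gt (max (6 * Real.pi * α / freq T) (α / (freq T) ^ 2))
  refine ⟨N, 3 / 4, by norm_num, fun k hk hkN => ?_⟩
  have hk1 := one_le_abs_of_mem_oddMultiples hκ hk
  have hb1 := ((le_max_left _ _).trans_lt hN).le.trans hkN.le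
  have hb2 := ((le_max_right _ _).trans_lt hN).le.trans hkN.le
  rw [div_le_iff₀ (by positivity)] at hb1 hb2
  set s := Real.sqrt ((freq T) ^ 2 * (k : ℝ) ^ 2 - α) with hs
  have hkk : |(k : ℝ)| ≤ (k : ℝ) ^ 2 := by
    rw [← sq_abs (k : ℝ)]
    nlinarith
  have hs2 : s ^ 2 = (freq T) ^ 2 * (k : ℝ) ^ 2 - α := by
    refine Real.sq_sqrt ?_
    have := mul_le_mul_of_nonneg_right hkk (sq_nonneg (freq T))
    linarith
  have hs0 : 0 ≤ s := Real.sqrt_nonneg _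
  set t := freq T * |(k : ℝ)| with ht
  have ht0 : 0 < t := by positivity
  have ht2 : t ^ 2 = (freq T) ^ 2 * (k : ℝ) ^ 2 := by rw [ht, mul_pow, sq_abs]
  have hst : |s - t| ≤ α / t := by
    rw [le_div_iff₀ ht0]
    have e : |s - t| * (s + t) = α := by
      have e2 : (s - t) * (s + t) = -α := by
        linear_combination hs2 - ht2
      rw [← abs_of_nonneg (add_nonneg hs0 ht0.le), ← abs_mul, e2, abs_neg, abs_of_nonneg hα]
    nlinarith [abs_nonneg (s - t)]
  have hcos0 : Real.cos (t * Real.pi) = 0 := by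
    have hodd : Odd ((k₀ : ℤ) * |k|) := by
      obtain ⟨m, hm, rfl⟩ := hk
      exact ((Int.odd_coe_nat _).2 hk₀).mul (odd_abs.2 (hκ.mul hm))
    obtain ⟨j, hj⟩ := hodd
    rw [Real.cos_eq_zero_iff]
    refine ⟨j, ?_⟩
    have hj' : (k₀ : ℝ) * |(k : ℝ)| = 2 * j + 1 := by exact_mod_cast hj
    rw [ht, hfreq, show (k₀ : ℝ) / 2 * |(k : ℝ)| * Real.pi = (k₀ * |(k : ℝ)|) * Real.pi / 2 by ring,
      hj']
  have hcos : |Real.cos (s * Real.pi)| ≤ 1 / 6 := by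
    have h1 := Real.lipschitzWith_cos.dist_le_mul (s * Real.pi) (t * Real.pi)
    rw [hcos0, Real.dist_eq, Real.dist_eq, sub_zero, ← sub_mul, abs_mul, abs_of_pos hπ,
      NNReal.coe_one, one_mul] at h1
    refine h1.trans ((mul_le_mul_of_nonneg_right hst hπ.le).trans ?_)
    rw [div_mul_eq_mul_div, div_le_iff₀ ht0]
    linarith
  rw [← sq_abs]
  nlinarith [abs_nonneg (Real.cos (s * Real.pi))]

theorem exists_band_eq {s : ℝ} (hs : 0 ≤ s) :
    ∃ m : ℤ, s = |Real.arccos (Real.cos (2 * Real.pi * s)) / (2 * Real.pi) + m| := by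
  have hπ := Real.pi_pos
  set d := Real.arccos (Real.cos (2 * Real.pi * s)) with hd
  have hc : Real.cos d = Real.cos (2 * Real.pi * s) :=
    Real.cos_arccos (Real.neg_one_le_cos _) (Real.cos_le_one _)
  obtain ⟨n, hn | hn⟩ := Real.cos_eq_cos_iff.1 hc
  · refine ⟨n, ?_⟩
    have e : d / (2 * Real.pi) + n = s := by
      field_simp
      linarith
    rw [e, abs_of_nonneg hs]
  · refine ⟨-n, ?_⟩
    have e : d / (2 * Real.pi) + ((-n : ℤ) : ℝ) = -s := by
      push_cast
      field_simp
      linarith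
    rw [e, abs_neg, abs_of_nonneg hs]

/-- Let d ∈ [0, 1/2] be the distance of s to ℤ. The bands are d ≤ d₀ with cos(2πd₀) = -7/9, so a
distance δ to all bands means d ≥ d₀ + δ, and the claim follows from 9 cos²(πs) = (9/2)(1 +
cos(2πs)). -/
theorem GapCondition.cosCondition {T α : ℝ} {κ : ℤ} (h : GapCondition T α κ) :
    CosCondition T α κ := by
  obtain ⟨K, δ, hδ, hgap⟩ := h
  have hπ := Real.pi_pos
  set d₀ := Real.arccos (-7 / 9) / (2 * Real.pi) with hd₀
  have hd₀π : 2 * Real.pi * d₀ = Real.arccos (-7 / 9) := by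
    rw [hd₀]
    field_simp
  have hcosd₀ : Real.cos (2 * Real.pi * d₀) = -7 / 9 := by
    rw [hd₀π, Real.cos_arccos (by norm_num) (by norm_num)]
  have hd₀0 : 0 ≤ d₀ := div_nonneg (Real.arccos_nonneg _) (by positivity)
  have hd₀lt : d₀ < 1 / 2 := by
    by_contra hcon
    push Not at hcon
    have h1 : 2 * Real.pi * d₀ = Real.pi := by
      refine le_antisymm (hd₀π.le.trans (Real.arccos_le_pi _)) ?_
      nlinarith
    rw [h1, Real.cos_pi] at hcosd₀
    norm_num at hcosd₀
  -- The truncation keeps 2π(d₀ + δ') in [0, π], where the cosine is monotone, before any k is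
  -- available.
  set δ' := min δ (1 / 2 - d₀) with hδ'
  have hδ'0 : 0 < δ' := lt_min hδ (by linarith)
  have hδ'le : d₀ + δ' ≤ 1 / 2 := by linarith [min_le_right δ (1 / 2 - d₀)]
  have hstrict : Real.cos (2 * Real.pi * (d₀ + δ')) < -7 / 9 := by
    rw [← hcosd₀]
    refine Real.cos_lt_cos_of_nonneg_of_le_pi (by positivity) (by nlinarith) ?_
    gcongr
    linarith
  refine ⟨K, 9 / 2 * (-7 / 9 - Real.cos (2 * Real.pi * (d₀ + δ'))), by linarith,
    fun k hk hkK => ?_⟩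
  have hkK' : (K : ℤ) < |k| := by exact_mod_cast hkK
  set s := Real.sqrt ((freq T) ^ 2 * (k : ℝ) ^ 2 - α) with hs
  have hs0 : 0 ≤ s := Real.sqrt_nonneg _
  have hdist : ∀ l ∈ Set.Ioc (-(1 / 2) : ℝ) (1 / 2), ∀ m : ℤ,
      δ ≤ |(|Real.arccos (1 / 9 * (8 * Real.cos (2 * Real.pi * l) + 1)) / (2 * Real.pi) + m|) - s| := by
    intro l hl m
    have h1 := (hgap l hl m k hk hkK').2
    rwa [band, Real.sqrt_sq_eq_abs, one_div_mul_eq_div] at h1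
  obtain ⟨m, hm⟩ := exists_band_eq hs0
  set d := Real.arccos (Real.cos (2 * Real.pi * s)) / (2 * Real.pi) with hd
  have hdπ : 2 * Real.pi * d = Real.arccos (Real.cos (2 * Real.pi * s)) := by
    rw [hd]
    field_simp
  have hcosd : Real.cos (2 * Real.pi * d) = Real.cos (2 * Real.pi * s) := by
    rw [hdπ, Real.cos_arccos (Real.neg_one_le_cos _) (Real.cos_le_one _)]
  have hdle : 2 * Real.pi * d ≤ Real.pi := hdπ.le.trans (Real.arccos_le_pi _)
  have hlt : d₀ < d := by
    by_contra hcon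
    push Not at hcon
    have hge : -7 / 9 ≤ Real.cos (2 * Real.pi * s) := by
      rw [← hcosd₀, ← hcosd]
      refine Real.cos_le_cos_of_nonneg_of_le_pi ?_ (by nlinarith) (by gcongr)
      rw [hdπ]
      exact Real.arccos_nonneg _
    -- If d ≤ d₀, the dispersion relation can be solved for a quasimomentum l at which the distance
    -- to the band function is zero.
    set l := Real.arccos ((9 * Real.cos (2 * Real.pi * s) - 1) / 8) / (2 * Real.pi) with hl
    have hlπ : 2 * Real.pi * l = Real.arccos ((9 * Real.cos (2 * Real.pi * s) - 1) / 8) := by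
      rw [hl]
      field_simp
    have hl0 : 0 ≤ l := div_nonneg (Real.arccos_nonneg _) (by positivity)
    have hl1 : l ≤ 1 / 2 := by
      have := hlπ.le.trans (Real.arccos_le_pi _)
      nlinarith
    have h1 := hdist l ⟨by linarith, hl1⟩ m
    rw [hlπ, Real.cos_arccos (by linarith) (by linarith [Real.cos_le_one (2 * Real.pi * s)]),
      show 1 / 9 * (8 * ((9 * Real.cos (2 * Real.pi * s) - 1) / 8) + 1) =
        Real.cos (2 * Real.pi * s) by ring, ← hd, ← hm, sub_self, abs_zero] at h1
    linarith
  have hge : d₀ + δ ≤ d := by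
    -- The quasimomentum 1/2 gives the band edge d₀.
    have h1 := hdist (1 / 2) ⟨by norm_num, le_rfl⟩ m
    rw [show 2 * Real.pi * (1 / 2) = Real.pi by ring, Real.cos_pi,
      show (1 : ℝ) / 9 * (8 * -1 + 1) = -7 / 9 by norm_num, ← hd₀] at h1
    rw [hm] at h1
    have h2 := h1.trans (abs_abs_sub_abs_le_abs_sub _ _)
    rw [add_sub_add_right_eq_sub, abs_sub_comm, abs_of_pos (sub_pos.2 hlt)] at h2
    linarith
  have hle : d₀ + δ' ≤ d := le_trans (by linarith [min_le_left δ (1 / 2 - d₀)]) hge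
  have hfin : Real.cos (2 * Real.pi * s) ≤ Real.cos (2 * Real.pi * (d₀ + δ')) := by
    rw [← hcosd]
    exact Real.cos_le_cos_of_nonneg_of_le_pi (by positivity) hdle (by gcongr)
  rw [Real.cos_sq, show 2 * (s * Real.pi) = 2 * Real.pi * s by ring]
  linarith

theorem calHEmbedsIntoH (T : ℝ) [Fact (0 < T)] {α : ℝ} (hα : 0 ≤ α) {κ : ℤ} (hκ : Odd κ)
    (hspec : SpecCondition T α κ)
    (h : (∃ k₀ : ℕ, Odd k₀ ∧ freq T = k₀ / 2) ∨ GapCondition T α κ) :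
    CalHEmbedsIntoH T α κ := by
  have hcos : CosCondition T α κ := by
    rcases h with ⟨k₀, hk₀, hfreq⟩ | h
    · exact cosCondition_of_half hα hκ hk₀ hfreq
    · exact h.cosCondition
  obtain ⟨B, hB⟩ := hcos.exists_resolvent_bound hspec
  exact calHEmbedsIntoH_of_resolvent_le hα hκ hspec hB

/-! ### Time-periodic functions -/

section Modes

variable (T : ℝ) [hT : Fact (0 < T)]

instance : SFinite graphMeasure := by
  unfold graphMeasure
  infer_instance

instance : IsFiniteMeasure (volume : Measure (AddCircle T)) := by
  rw [AddCircle.volume_eq_smul_haarAddCircle]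
  exact Measure.smul_finite _ ENNReal.ofReal_ne_top

theorem memLp_mode (k : ℤ) (f : L2) :
    MemLp (fun p : Pt × AddCircle T => f p.1 * fourier k p.2) 2 (spaceTimeMeasure T) := by
  have h1 : MemLp (fun p : Pt × AddCircle T => f p.1) 2 (spaceTimeMeasure T) :=
    (Lp.memLp f).comp_fst volume
  have h2 : Continuous fun t : AddCircle T => (fourier k t : ℂ) := (fourier k).continuous
  refine h1.of_le (h1.1.mul (h2.comp_aestronglyMeasurable
    measurable_snd.aestronglyMeasurable)) (ae_of_all _ fun p => ?_)
  rw [norm_mul, fourier_apply, Circle.norm_coe, mul_one]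

/-- The function `f(x) e^{iωkt}`. -/
def mode (k : ℤ) (f : L2) : Lp ℂ 2 (spaceTimeMeasure T) := (memLp_mode T k f).toLp _

/-- The factor T appears because the exponentials are orthonormal for the normalized Haar measure,
whereas the torus has mass T. -/
theorem integral_conj_fourier_mul (k l : ℤ) :
    ∫ t : AddCircle T, starRingEnd ℂ (fourier k t) * fourier l t = if k = l then (T : ℂ) else 0 := by
  have h := orthonormal_iff_ite.1 (orthonormal_fourier (T := T)) k l
  rw [ContinuousMap.inner_toLp (@AddCircle.haarAddCircle T hT) (fourier k) (fourier l),
    AddCircle.integral_haarAddCircle] at h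
  have hT0 : (T : ℂ) ≠ 0 := by exact_mod_cast hT.out.ne'
  simp only [mul_comm (starRingEnd ℂ _)]
  rw [Complex.real_smul, Complex.ofReal_inv, inv_mul_eq_iff_eq_mul₀ hT0] at h
  rw [h]
  split_ifs <;> simp

theorem inner_mode (k l : ℤ) (f g : L2) :
    inner ℂ (mode T k f) (mode T l g) = if k = l then (T : ℂ) * inner ℂ f g else 0 := by
  have h1 : inner ℂ (mode T k f) (mode T l g) =
      ∫ p : Pt × AddCircle T, (g p.1 * starRingEnd ℂ (f p.1)) *
        (starRingEnd ℂ (fourier k p.2) * fourier l p.2) ∂spaceTimeMeasure T := by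
    rw [L2.inner_def]
    refine integral_congr_ae ?_
    filter_upwards [(memLp_mode T k f).coeFn_toLp, (memLp_mode T l g).coeFn_toLp] with p hp hq
    rw [mode, mode, hp, hq]
    simp
    ring
  rw [h1, spaceTimeMeasure, integral_prod_mul (fun x => g x * starRingEnd ℂ (f x))
    (fun t : AddCircle T => starRingEnd ℂ (fourier k t) * fourier l t),
    integral_conj_fourier_mul, L2.inner_def]
  split_ifs
  · simp [mul_comm]
  · simp

theorem norm_sq_sum_mode (s : Finset ℤ) (u : ℤ → L2) :
    ‖∑ k ∈ s, mode T k (u k)‖ ^ 2 = ∑ k ∈ s, T * ‖u k‖ ^ 2 := by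
  have h : inner ℂ (∑ k ∈ s, mode T k (u k)) (∑ k ∈ s, mode T k (u k)) =
      ∑ k ∈ s, (T : ℂ) * inner ℂ (u k) (u k) := by
    rw [sum_inner]
    refine Finset.sum_congr rfl fun k hk => ?_
    rw [inner_sum]
    simp only [inner_mode]
    rw [Finset.sum_ite_eq, if_pos hk]
  simp only [inner_self_eq_norm_sq_to_K] at h
  rw [← Complex.ofReal_inj]
  push_cast
  exact h

theorem summable_mode {u : ℤ → L2} (hu : Summable fun k => ‖u k‖ ^ 2) :
    Summable fun k => mode T k (u k) := by
  have h1 := summable_iff_vanishing_norm.1 (hu.mul_left T)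
  rw [summable_iff_vanishing_norm]
  intro ε hε
  obtain ⟨s, hs⟩ := h1 (ε ^ 2) (by positivity)
  refine ⟨s, fun t ht => ?_⟩
  have h2 := (le_abs_self _).trans_lt (hs t ht)
  rw [← norm_sq_sum_mode] at h2
  exact lt_of_pow_lt_pow_left₀ 2 hε.le h2

theorem coeFn_sum_mode (s : Finset ℤ) (u : ℤ → L2) :
    ⇑(∑ k ∈ s, mode T k (u k)) =ᵐ[spaceTimeMeasure T]
      fun p => ∑ k ∈ s, u k p.1 * fourier k p.2 := by
  induction s using Finset.induction_on with
  | empty =>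
    simp only [Finset.sum_empty]
    exact Lp.coeFn_zero _ _ _
  | insert k s hk ih =>
    rw [Finset.sum_insert hk]
    filter_upwards [Lp.coeFn_add (mode T k (u k)) (∑ k ∈ s, mode T k (u k)), ih,
      (memLp_mode T k (u k)).coeFn_toLp] with p h1 h2 h3
    rw [h1, Pi.add_apply, h2, mode, h3, Finset.sum_insert hk]

theorem isTimeSeries_iff {u : ℤ → L2symm} {U : Pt × AddCircle T → ℂ} :
    IsTimeSeries T u U ↔ ∃ hU : MemLp U 2 (spaceTimeMeasure T),
      HasSum (fun k => mode T k (u k)) (hU.toLp U) := by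
  have key : ∀ hU : MemLp U 2 (spaceTimeMeasure T),
      HasSum (fun k => mode T k (u k)) (hU.toLp U) ↔ Filter.Tendsto
      (fun s : Finset ℤ =>
        eLpNorm (fun p => U p - ∑ k ∈ s, (u k : L2) p.1 * fourier k p.2) 2 (spaceTimeMeasure T))
      Filter.atTop (nhds 0) := by
    intro hU
    rw [HasSum, SummationFilter.unconditional_filter, Lp.tendsto_Lp_iff_tendsto_eLpNorm]
    refine Filter.tendsto_congr fun s => ?_
    rw [eLpNorm_sub_comm]
    refine eLpNorm_congr_ae ?_
    filter_upwards [coeFn_sum_mode T s fun k => (u k : L2)] with p hp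
    rw [Pi.sub_apply, hp]
  constructor
  · rintro ⟨h1, h2⟩
    exact ⟨h1, (key h1).2 h2⟩
  · rintro ⟨h1, h2⟩
    exact ⟨h1, (key h1).1 h2⟩

theorem inner_mode_of_hasSum {u : ℤ → L2} {x : Lp ℂ 2 (spaceTimeMeasure T)}
    (h : HasSum (fun k => mode T k (u k)) x) (k : ℤ) (g : L2) :
    inner ℂ (mode T k g) x = (T : ℂ) * inner ℂ g (u k) := by
  have h1 := (innerSL ℂ (mode T k g)).hasSum h
  simp only [innerSL_apply_apply, inner_mode] at h1
  refine h1.unique ?_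
  convert hasSum_single k fun l hl => ?_ using 1
  · simp
  · exact if_neg hl.symm

/-- Orthogonality recovers u k weakly, by testing the sum with g(x) e^{iωkt} for all g. -/
theorem eq_of_hasSum_mode {u v : ℤ → L2} {x : Lp ℂ 2 (spaceTimeMeasure T)}
    (hu : HasSum (fun k => mode T k (u k)) x) (hv : HasSum (fun k => mode T k (v k)) x) :
    u = v := by
  have hT0 : (T : ℂ) ≠ 0 := by exact_mod_cast hT.out.ne'
  refine funext fun k => ext_inner_left ℂ fun g => ?_
  exact mul_left_cancel₀ hT0
    ((inner_mode_of_hasSum T hu k g).symm.trans (inner_mode_of_hasSum T hv k g))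

open Classical in
/-- Bessel's inequality for the remainder of the series. -/
theorem norm_sq_sub_sum_mode_le {u : ℤ → L2} {x : Lp ℂ 2 (spaceTimeMeasure T)}
    (h : HasSum (fun k => mode T k (u k)) x) (s : Finset ℤ) :
    ENNReal.ofReal (‖x - ∑ k ∈ s, mode T k (u k)‖ ^ 2) ≤
      ∑' k, if k ∈ s then 0 else ENNReal.ofReal (T * ‖u k‖ ^ 2) := by
  have hlim : Filter.Tendsto (fun t : Finset ℤ => ENNReal.ofReal
      (‖(∑ k ∈ t, mode T k (u k)) - ∑ k ∈ s, mode T k (u k)‖ ^ 2)) Filter.atTop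
      (nhds (ENNReal.ofReal (‖x - ∑ k ∈ s, mode T k (u k)‖ ^ 2))) := by
    rw [HasSum, SummationFilter.unconditional_filter] at h
    exact ENNReal.tendsto_ofReal ((h.sub_const _).norm.pow 2)
  refine le_of_tendsto hlim ?_
  filter_upwards [Filter.eventually_ge_atTop s] with t ht
  rw [← Finset.sum_sdiff ht, add_sub_cancel_right, norm_sq_sum_mode,
    ENNReal.ofReal_sum_of_nonneg fun k _ => mul_nonneg hT.out.le (sq_nonneg _)]
  refine le_trans (le_of_eq ?_) (ENNReal.sum_le_tsum (t \ s))
  refine Finset.sum_congr rfl fun k hk => ?_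
  rw [if_neg (Finset.mem_sdiff.1 hk).2]

end Modes

/-! ### Embedding into `L^q` -/

theorem sq_norm_sum_fourier_le {T : ℝ} {s : Finset ℤ} {z : ℤ → ℂ} {c : ℤ → ℝ}
    (hz : ∀ k ∈ s, ‖z k‖ ^ 2 ≤ c k) (t : AddCircle T) :
    ‖∑ k ∈ s, z k * fourier k t‖ ^ 2 ≤ s.card * ∑ k ∈ s, c k := by
  have h1 : ‖∑ k ∈ s, z k * fourier k t‖ ≤ ∑ k ∈ s, ‖z k‖ := by
    refine (norm_sum_le _ _).trans (Finset.sum_le_sum fun k _ => ?_)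
    rw [norm_mul, fourier_apply, Circle.norm_coe, mul_one]
  refine (pow_le_pow_left₀ (norm_nonneg _) h1 2).trans (sq_sum_le_card_mul_sum_sq.trans ?_)
  exact mul_le_mul_of_nonneg_left (Finset.sum_le_sum hz) (Nat.cast_nonneg _)

section Embedding

variable {T : ℝ} [hT : Fact (0 < T)]

open Classical in
/-- Weak-type estimate at the level `l`. -/
theorem meas_lt_norm_le {u : ℤ → L2} {a : ℤ → ℝ} {A : ℝ} (hA : 0 < A) (ha : ∀ k, 0 ≤ a k)
    (hsum : HasSum a A) (h0 : u 0 = 0) (hL2 : ∀ k : ℤ, |(k : ℝ)| * ‖u k‖ ^ 2 ≤ a k)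
    (hsup : ∀ k, ∀ᵐ x ∂graphMeasure, ‖u k x‖ ^ 2 ≤ 2 * a k) {U : Pt × AddCircle T → ℂ}
    (hU : MemLp U 2 (spaceTimeMeasure T)) (h : HasSum (fun k => mode T k (u k)) (hU.toLp U))
    {l : ℝ} (hl : 0 < l) :
    spaceTimeMeasure T {p | l < ‖U p‖} ≤ ENNReal.ofReal (4 / l ^ 2) *
      ∑' k : ℤ, if l ^ 2 < 16 * A * |(k : ℝ)| then ENNReal.ofReal (T * (a k / |(k : ℝ)|)) else 0 := by
  set N := ⌊l ^ 2 / (16 * A)⌋₊ with hN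
  set s := (Finset.Icc (-(N : ℤ)) N).erase 0 with hs
  have hcard : (s.card : ℝ) ≤ 2 * N := by
    have h1 : s.card = 2 * N := by
      rw [hs, Finset.card_erase_of_mem (by simp), Int.card_Icc]
      omega
    exact_mod_cast h1.le
  have hNle : 16 * A * (N : ℝ) ≤ l ^ 2 := by
    have h1 := Nat.floor_le (show 0 ≤ l ^ 2 / (16 * A) by positivity)
    rw [le_div_iff₀ (by positivity)] at h1
    linarith
  set V := hU.toLp U - ∑ k ∈ s, mode T k (u k) with hV
  have hsupAll : ∀ᵐ p ∂spaceTimeMeasure T, ∀ k, ‖u k p.1‖ ^ 2 ≤ 2 * a k :=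
    Measure.quasiMeasurePreserving_fst.ae (ae_all_iff.2 hsup)
  have hsub : ∀ᵐ p ∂spaceTimeMeasure T, l < ‖U p‖ → ENNReal.ofReal (l / 2) ≤ ‖V p‖ₑ := by
    filter_upwards [hsupAll, coeFn_sum_mode T s u, hU.coeFn_toLp,
      Lp.coeFn_sub (hU.toLp U) (∑ k ∈ s, mode T k (u k))] with p h1 h2 h3 h4 hlp
    have h5 : ‖∑ k ∈ s, u k p.1 * fourier k p.2‖ ≤ l / 2 := by
      have h6 := sq_norm_sum_fourier_le (s := s) (fun k _ => h1 k) p.2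
      rw [← Finset.mul_sum] at h6
      have h7 : ∑ k ∈ s, a k ≤ A := sum_le_hasSum s (fun k _ => ha k) hsum
      have h8 : 0 ≤ ∑ k ∈ s, a k := Finset.sum_nonneg fun k _ => ha k
      refine (abs_le_of_sq_le_sq' (h6.trans ?_) (by positivity)).2
      have h9 : (s.card : ℝ) * (2 * ∑ k ∈ s, a k) ≤ 2 * N * (2 * A) := by gcongr
      linarith
    rw [hV, h4, Pi.sub_apply, h2, h3, ← ofReal_norm]
    refine ENNReal.ofReal_le_ofReal ?_
    have := norm_sub_norm_le (U p) (∑ k ∈ s, u k p.1 * fourier k p.2)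
    linarith
  -- Chebyshev's inequality in L² for the high-frequency remainder V.
  have hmark := mul_meas_ge_le_pow_eLpNorm' (spaceTimeMeasure T) (p := 2) two_ne_zero
    ENNReal.ofNat_ne_top (Lp.aestronglyMeasurable V) (ENNReal.ofReal (l / 2))
  rw [← Lp.enorm_def, ENNReal.toReal_ofNat, ENNReal.ofReal_rpow_of_nonneg (by positivity)
    (by norm_num), ← ofReal_norm, ENNReal.ofReal_rpow_of_nonneg (norm_nonneg _) (by norm_num),
    Real.rpow_two, Real.rpow_two] at hmark
  have htail := norm_sq_sub_sum_mode_le T h s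
  have hcomp : (∑' k, if k ∈ s then 0 else ENNReal.ofReal (T * ‖u k‖ ^ 2)) ≤
      ∑' k : ℤ, if l ^ 2 < 16 * A * |(k : ℝ)| then ENNReal.ofReal (T * (a k / |(k : ℝ)|)) else 0 := by
    refine ENNReal.tsum_le_tsum fun k => ?_
    by_cases hk : k ∈ s
    · rw [if_pos hk]
      exact zero_le
    rw [if_neg hk]
    by_cases hk0 : k = 0
    · rw [hk0, h0]
      simp
    have hkN : (N : ℤ) < |k| := by
      by_contra hcon
      push Not at hcon
      exact hk (Finset.mem_erase.2 ⟨hk0, Finset.mem_Icc.2 (abs_le.1 hcon)⟩)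
    have hkN' : (N : ℝ) + 1 ≤ |(k : ℝ)| := by exact_mod_cast hkN
    have h1 := Nat.lt_floor_add_one (l ^ 2 / (16 * A))
    rw [div_lt_iff₀ (by positivity)] at h1
    have hlk : l ^ 2 < 16 * A * |(k : ℝ)| := by
      refine h1.trans_le ?_
      rw [mul_comm]
      gcongr
    rw [if_pos hlk]
    refine ENNReal.ofReal_le_ofReal (mul_le_mul_of_nonneg_left ?_ hT.out.le)
    rw [le_div_iff₀ (by positivity), mul_comm]
    exact hL2 k
  have hm1 : spaceTimeMeasure T {p | l < ‖U p‖} ≤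
      spaceTimeMeasure T {p | ENNReal.ofReal (l / 2) ≤ ‖V p‖ₑ} := measure_mono_ae hsub
  have hm2 := (mul_le_mul_right hm1 (ENNReal.ofReal ((l / 2) ^ 2))).trans
    (hmark.trans (htail.trans hcomp))
  have hm3 := mul_le_mul_right hm2 (ENNReal.ofReal (4 / l ^ 2))
  rwa [← mul_assoc, ← ENNReal.ofReal_mul (by positivity),
    show 4 / l ^ 2 * (l / 2) ^ 2 = 1 by field_simp; norm_num, ENNReal.ofReal_one, one_mul] at hm3

/-- The k-th term is active only for t < √(16A|k|). Integrability of t^{q-3} at 0 uses q > 2, and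
the resulting power |k|^{(q-2)/2} is absorbed by the factor 1/|k| since q < 4. -/
theorem lintegral_level_le {q A c : ℝ} (hq : 2 < q) (hq4 : q < 4) (hA : 0 < A) (hc : 0 ≤ c)
    (k : ℤ) :
    ∫⁻ t in Set.Ioi (0 : ℝ), (if t ^ 2 < 16 * A * |(k : ℝ)| then
      ENNReal.ofReal (c / |(k : ℝ)| * t ^ (q - 3)) else 0) ≤
      ENNReal.ofReal ((16 * A) ^ ((q - 2) / 2) / (q - 2) * c) := by
  by_cases hk : k = 0
  · subst hk
    have : ∀ t : ℝ, ¬ t ^ 2 < 0 := fun t => not_lt.2 (sq_nonneg t)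
    simp [this]
  have hk1 : 1 ≤ |(k : ℝ)| := by exact_mod_cast Int.one_le_abs hk
  set M := Real.sqrt (16 * A * |(k : ℝ)|) with hM
  have hM0 : 0 ≤ M := Real.sqrt_nonneg _
  have hle : ∀ t ∈ Set.Ioi (0 : ℝ), (if t ^ 2 < 16 * A * |(k : ℝ)| then
      ENNReal.ofReal (c / |(k : ℝ)| * t ^ (q - 3)) else 0) ≤
      (Set.Ioc 0 M).indicator (fun t => ENNReal.ofReal (c / |(k : ℝ)| * t ^ (q - 3))) t := by
    intro t ht
    split_ifs with h
    · rw [Set.indicator_of_mem]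
      exact ⟨ht, (Real.lt_sqrt_of_sq_lt h).le⟩
    · exact zero_le
  refine (setLIntegral_mono' measurableSet_Ioi hle).trans ?_
  refine (setLIntegral_le_lintegral _ _).trans ?_
  rw [lintegral_indicator measurableSet_Ioc]
  have hint : IntervalIntegrable (fun t : ℝ => c / |(k : ℝ)| * t ^ (q - 3)) volume 0 M :=
    (intervalIntegral.intervalIntegrable_rpow' (by linarith)).const_mul _
  rw [intervalIntegrable_iff_integrableOn_Ioc_of_le hM0] at hint
  rw [← ofReal_integral_eq_lintegral_ofReal hint (by
    filter_upwards [ae_restrict_mem measurableSet_Ioc] with t ht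
    have := ht.1
    simp only [Pi.zero_apply]
    positivity), ← intervalIntegral.integral_of_le hM0, intervalIntegral.integral_const_mul,
    integral_rpow (Or.inl (by linarith))]
  refine ENNReal.ofReal_le_ofReal ?_
  have hq2 : 0 < q - 2 := by linarith
  rw [show q - 3 + 1 = q - 2 by ring, Real.zero_rpow hq2.ne', sub_zero, hM, Real.sqrt_eq_rpow,
    ← Real.rpow_mul (by positivity), Real.mul_rpow (by positivity) (by positivity),
    show 1 / 2 * (q - 2) = (q - 2) / 2 by ring]
  have hkle : |(k : ℝ)| ^ ((q - 2) / 2) ≤ |(k : ℝ)| := by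
    calc |(k : ℝ)| ^ ((q - 2) / 2) ≤ |(k : ℝ)| ^ (1 : ℝ) :=
          Real.rpow_le_rpow_of_exponent_le hk1 (by linarith)
      _ = |(k : ℝ)| := Real.rpow_one _
  calc c / |(k : ℝ)| * ((16 * A) ^ ((q - 2) / 2) * |(k : ℝ)| ^ ((q - 2) / 2) / (q - 2))
      ≤ c / |(k : ℝ)| * ((16 * A) ^ ((q - 2) / 2) * |(k : ℝ)| / (q - 2)) := by gcongr
    _ = (16 * A) ^ ((q - 2) / 2) / (q - 2) * c := by
        have : |(k : ℝ)| ≠ 0 := by positivity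
        field_simp

/-- Layer-cake formula with the weak-type estimate, followed by exchanging the sum over k and the
integral over the levels. -/
theorem lintegral_rpow_norm_le {u : ℤ → L2} {a : ℤ → ℝ} {A : ℝ} (hA : 0 < A) (ha : ∀ k, 0 ≤ a k)
    (hsum : HasSum a A) (h0 : u 0 = 0) (hL2 : ∀ k : ℤ, |(k : ℝ)| * ‖u k‖ ^ 2 ≤ a k)
    (hsup : ∀ k, ∀ᵐ x ∂graphMeasure, ‖u k x‖ ^ 2 ≤ 2 * a k) {U : Pt × AddCircle T → ℂ}
    (hU : MemLp U 2 (spaceTimeMeasure T)) (h : HasSum (fun k => mode T k (u k)) (hU.toLp U))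
    {q : ℝ} (hq : 2 < q) (hq4 : q < 4) :
    ∫⁻ p, ENNReal.ofReal (‖U p‖ ^ q) ∂spaceTimeMeasure T ≤
      ENNReal.ofReal (q * ((16 * A) ^ ((q - 2) / 2) / (q - 2) * (4 * T * A))) := by
  classical
  have hT0 := hT.out
  have hq2 : 0 < q - 2 := by linarith
  rw [lintegral_rpow_eq_lintegral_meas_lt_mul _ (ae_of_all _ fun _ => norm_nonneg _)
    hU.1.norm.aemeasurable (by linarith), ENNReal.ofReal_mul (by linarith)]
  refine mul_le_mul_right ?_ _
  have hpt : ∀ t ∈ Set.Ioi (0 : ℝ), spaceTimeMeasure T {p | t < ‖U p‖} *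
      ENNReal.ofReal (t ^ (q - 1)) ≤ ∑' k : ℤ, (if t ^ 2 < 16 * A * |(k : ℝ)| then
        ENNReal.ofReal (4 * T * a k / |(k : ℝ)| * t ^ (q - 3)) else 0) := by
    intro t ht
    have ht0 : 0 < t := ht
    refine (mul_le_mul_left (meas_lt_norm_le hA ha hsum h0 hL2 hsup hU h ht0) _).trans
      (le_of_eq ?_)
    rw [← ENNReal.tsum_mul_left, ← ENNReal.tsum_mul_right]
    refine tsum_congr fun k => ?_
    split_ifs
    · have hak : 0 ≤ a k / |(k : ℝ)| := div_nonneg (ha k) (abs_nonneg _)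
      rw [← ENNReal.ofReal_mul (by positivity), ← ENNReal.ofReal_mul (by positivity)]
      congr 1
      rw [show q - 1 = (q - 3) + 2 by ring, Real.rpow_add ht0, Real.rpow_two]
      field_simp
    · simp
  refine (setLIntegral_mono' measurableSet_Ioi hpt).trans ?_
  rw [lintegral_tsum fun k => (Measurable.ite (measurableSet_lt (by fun_prop) measurable_const)
    (by fun_prop) measurable_const).aemeasurable]
  have hterm := fun k => lintegral_level_le hq hq4 hA
    (show 0 ≤ 4 * T * a k from mul_nonneg (by positivity) (ha k)) k
  refine (ENNReal.tsum_le_tsum hterm).trans (le_of_eq ?_)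
  have hs := (hsum.mul_left (4 * T)).mul_left ((16 * A) ^ ((q - 2) / 2) / (q - 2))
  rw [← hs.tsum_eq]
  exact (ENNReal.ofReal_tsum_of_nonneg (fun k => mul_nonneg (by positivity)
    (mul_nonneg (by positivity) (ha k))) hs.summable).symm

end Embedding

open Classical in
/-- The terms of the squared norm of `H`. -/
def hTerm (κ : ℤ) (u : ℤ → L2symm) (k : ℤ) : ℝ :=
  if k ∈ oddMultiples κ then
    1 / |(k : ℝ)| * ‖h1Deriv (u k)‖ ^ 2 + |(k : ℝ)| * ‖u k‖ ^ 2
  else 0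

theorem hTerm_nonneg (κ : ℤ) (u : ℤ → L2symm) (k : ℤ) : 0 ≤ hTerm κ u k := by
  unfold hTerm
  split_ifs <;> positivity

theorem exists_hasSum_hTerm {κ : ℤ} {u : ℤ → L2symm} (hu : u ∈ H κ) :
    ∃ A, HasSum (hTerm κ u) A ∧ hNorm κ u = ENNReal.ofReal A ^ (1 / 2 : ℝ) := by
  have hsub : (∑' k : oddMultiples κ, ENNReal.ofReal
      (1 / |((k : ℤ) : ℝ)| * ‖h1Deriv (u k)‖ ^ 2 + |((k : ℤ) : ℝ)| * ‖u k‖ ^ 2)) =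
      ∑' k, ENNReal.ofReal (hTerm κ u k) := by
    rw [tsum_subtype (oddMultiples κ) fun k : ℤ => ENNReal.ofReal
      (1 / |(k : ℝ)| * ‖h1Deriv (u k)‖ ^ 2 + |(k : ℝ)| * ‖u k‖ ^ 2)]
    refine tsum_congr fun k => ?_
    by_cases hk : k ∈ oddMultiples κ <;> simp [hTerm, hk]
  have hne : ∑' k, ENNReal.ofReal (hTerm κ u k) ≠ ∞ := by
    have h1 := hu.2
    rw [hNorm, hsub] at h1
    intro htop
    rw [htop, ENNReal.top_rpow_of_pos (by norm_num)] at h1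
    exact lt_irrefl _ h1
  have hsum : Summable (hTerm κ u) := by
    have h1 := ENNReal.summable_toReal hne
    simpa only [ENNReal.toReal_ofReal (hTerm_nonneg κ u _)] using h1
  refine ⟨∑' k, hTerm κ u k, hsum.hasSum, ?_⟩
  rw [hNorm, hsub, ENNReal.ofReal_tsum_of_nonneg (hTerm_nonneg κ u) hsum]

/-! ### Termwise bounds by the norm of `H` -/

section

variable {κ : ℤ} {u : ℤ → L2symm}

theorem mul_norm_sq_le_hTerm (hu : Admissible κ u) (k : ℤ) :
    |(k : ℝ)| * ‖(u k : L2)‖ ^ 2 ≤ hTerm κ u k := by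
  unfold hTerm
  split_ifs with hk
  · exact le_add_of_nonneg_left (by positivity)
  · rw [hu.1 k hk]
    simp

theorem norm_sq_le_hTerm (hκ : Odd κ) (hu : Admissible κ u) (k : ℤ) :
    ‖(u k : L2)‖ ^ 2 ≤ hTerm κ u k := by
  by_cases hk : k ∈ oddMultiples κ
  · refine le_trans ?_ (mul_norm_sq_le_hTerm hu k)
    exact le_mul_of_one_le_left (sq_nonneg _) (one_le_abs_of_mem_oddMultiples hκ hk)
  · rw [hu.1 k hk]
    simpa using hTerm_nonneg κ u k

theorem ae_norm_sq_le_hTerm (hκ : Odd κ) (hu : Admissible κ u) (k : ℤ) :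
    ∀ᵐ x ∂graphMeasure, ‖(u k : L2) x‖ ^ 2 ≤ 2 * hTerm κ u k := by
  by_cases hk : k ∈ oddMultiples κ
  · obtain ⟨v, hv⟩ := (hu.2 k hk).1
    have hk1 := one_le_abs_of_mem_oddMultiples hκ hk
    have hk0 : 0 < |(k : ℝ)| := by linarith
    have hderiv := h1Deriv_eq hv
    obtain ⟨f, hf, hp, -⟩ := hv
    rw [ae_graph_iff]
    intro i
    filter_upwards [onEdge_congr hf i, ae_restrict_mem measurableSet_Icc] with y hy hym
    -- The length scale 1/|k| reproduces the weights of the norm of `H`; it is admissible because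
    -- 1/|k| ≤ 1 ≤ π.
    have h1 := norm_sq_le_of_edgewisePrimitive hf hp i hym (h := 1 / |(k : ℝ)|) (by positivity)
      (((div_le_one hk0).2 hk1).trans (by linarith [Real.pi_gt_three]))
    rw [hy] at h1
    refine h1.trans ?_
    rw [hTerm, if_pos hk, hderiv]
    have h2 := edgeSq_le (u k) i
    have h3 := edgeSq_le v i
    have h4 : 2 / (1 / |(k : ℝ)|) * edgeSq (u k) i ≤ 2 * (|(k : ℝ)| * ‖(u k : L2)‖ ^ 2) := by
      rw [div_div_eq_mul_div, div_one, mul_assoc]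
      gcongr
    have h5 : 2 * (1 / |(k : ℝ)|) * edgeSq v i ≤ 2 * (1 / |(k : ℝ)| * ‖v‖ ^ 2) := by
      rw [mul_assoc]
      gcongr
    rw [Submodule.coe_norm]
    linarith
  · rw [hu.1 k hk]
    filter_upwards [Lp.coeFn_zero ℂ 2 graphMeasure] with x hx
    have := hTerm_nonneg κ u k
    rw [ZeroMemClass.coe_zero, hx]
    simpa using this

theorem apply_zero_of_admissible (hκ : Odd κ) (hu : Admissible κ u) : (u 0 : L2) = 0 := by
  have : (0 : ℤ) ∉ oddMultiples κ := fun h => ne_zero_of_mem_oddMultiples hκ h rfl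
  rw [hu.1 0 this]
  rfl

end

/-- The constant of the embedding into `L^q`, to the power `q`. -/
def embConst (T q : ℝ) : ℝ := q * (16 ^ ((q - 2) / 2) / (q - 2) * (4 * T))

theorem eLpNorm_le_of_mem_H {T : ℝ} [hT : Fact (0 < T)] {κ : ℤ} (hκ : Odd κ) {q : ℝ} (hq : 2 < q)
    (hq4 : q < 4) {u : ℤ → L2symm} (hu : u ∈ H κ) {U : Pt × AddCircle T → ℂ}
    (hU : IsTimeSeries T u U) :
    eLpNorm U (ENNReal.ofReal q) (spaceTimeMeasure T) ≤
      ENNReal.ofReal (embConst T q ^ (1 / q)) * hNorm κ u := by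
  have hT0 := hT.out
  have hq0 : 0 < q := by linarith
  have hq2 : 0 < q - 2 := by linarith
  obtain ⟨hU2, hsum⟩ := (isTimeSeries_iff T).1 hU
  obtain ⟨A, hA, hnorm⟩ := exists_hasSum_hTerm hu
  have hA0 : 0 ≤ A := hA.nonneg (hTerm_nonneg κ u)
  -- The frequency cut-off divides by A, so the zero function is treated separately.
  rcases hA0.eq_or_lt with hA0 | hA0
  · have hzero : ∀ k, (u k : L2) = 0 := by
      intro k
      have h1 := (norm_sq_le_hTerm hκ hu.1 k).trans
        ((le_hasSum hA k fun j _ => hTerm_nonneg κ u j).trans hA0.symm.le)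
      simpa using le_antisymm h1 (sq_nonneg _)
    have hx : ∀ x, HasSum (fun k => mode T k (u k)) x → x = 0 := by
      intro x hx
      have h1 := norm_sq_sub_sum_mode_le T hx ∅
      simpa [hzero] using h1
    have hae : U =ᵐ[spaceTimeMeasure T] 0 := by
      exact (MemLp.toLp_eq_toLp_iff hU2 MemLp.zero).1 ((hx _ hsum).trans (MemLp.toLp_zero _).symm)
    rw [eLpNorm_congr_ae hae, eLpNorm_zero]
    exact zero_le
  · have h1 := lintegral_rpow_norm_le hA0 (hTerm_nonneg κ u) hA
      (apply_zero_of_admissible hκ hu.1) (mul_norm_sq_le_hTerm hu.1)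
      (ae_norm_sq_le_hTerm hκ hu.1) hU2 hsum hq hq4
    -- The powers of A combine to A^{q/2}, so the q-th root is linear in the norm of `H`.
    have hconst : q * ((16 * A) ^ ((q - 2) / 2) / (q - 2) * (4 * T * A)) =
        embConst T q * A ^ (q / 2) := by
      rw [show q / 2 = (q - 2) / 2 + 1 by ring, Real.rpow_add hA0, Real.rpow_one,
        Real.mul_rpow (by norm_num) hA0.le, embConst]
      ring
    have hE0 : 0 ≤ embConst T q := by
      unfold embConst
      positivity
    rw [eLpNorm_eq_lintegral_rpow_enorm_toReal (by simpa using hq0) ENNReal.ofReal_ne_top,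
      ENNReal.toReal_ofReal hq0.le, hnorm, ENNReal.ofReal_rpow_of_nonneg hA0.le (by norm_num),
      ← ENNReal.ofReal_mul (by positivity)]
    have h2 : ∫⁻ p, ‖U p‖ₑ ^ q ∂spaceTimeMeasure T =
        ∫⁻ p, ENNReal.ofReal (‖U p‖ ^ q) ∂spaceTimeMeasure T := by
      refine lintegral_congr fun p => ?_
      rw [← ofReal_norm, ENNReal.ofReal_rpow_of_nonneg (norm_nonneg _) hq0.le]
    rw [h2]
    refine (ENNReal.rpow_le_rpow h1 (by positivity)).trans (le_of_eq ?_)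
    rw [hconst, ENNReal.ofReal_rpow_of_nonneg (by positivity) (by positivity),
      Real.mul_rpow hE0 (by positivity), ← Real.rpow_mul hA0.le]
    congr 3
    field_simp

theorem eLpNorm_two_le_of_mem_H {T : ℝ} [hT : Fact (0 < T)] {κ : ℤ} (hκ : Odd κ)
    {u : ℤ → L2symm} (hu : u ∈ H κ) {U : Pt × AddCircle T → ℂ} (hU : IsTimeSeries T u U) :
    eLpNorm U 2 (spaceTimeMeasure T) ≤ ENNReal.ofReal (T ^ (1 / 2 : ℝ)) * hNorm κ u := by
  obtain ⟨hU2, hsum⟩ := (isTimeSeries_iff T).1 hU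
  obtain ⟨A, hA, hnorm⟩ := exists_hasSum_hTerm hu
  have hA0 : 0 ≤ A := hA.nonneg (hTerm_nonneg κ u)
  have h1 := norm_sq_sub_sum_mode_le T hsum ∅
  simp only [Finset.sum_empty, sub_zero, Finset.notMem_empty, if_false] at h1
  have h2 : ∑' k, ENNReal.ofReal (T * ‖(u k : L2)‖ ^ 2) ≤ ENNReal.ofReal (T * A) := by
    rw [← (hA.mul_left T).tsum_eq, ENNReal.ofReal_tsum_of_nonneg
      (fun k => mul_nonneg hT.out.le (hTerm_nonneg κ u k)) (hA.mul_left T).summable]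
    exact ENNReal.tsum_le_tsum fun k => ENNReal.ofReal_le_ofReal
      (mul_le_mul_of_nonneg_left (norm_sq_le_hTerm hκ hu.1 k) hT.out.le)
  have h3 := (ENNReal.ofReal_le_ofReal_iff (mul_nonneg hT.out.le hA0)).1 (h1.trans h2)
  rw [hnorm, ENNReal.ofReal_rpow_of_nonneg hA0 (by norm_num),
    ← ENNReal.ofReal_mul (Real.rpow_nonneg hT.out.le _), ← Real.mul_rpow hT.out.le hA0,
    ← Real.sqrt_eq_rpow, ← eLpNorm_congr_ae hU2.coeFn_toLp, ← Lp.enorm_def, ← ofReal_norm]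
  exact ENNReal.ofReal_le_ofReal (Real.le_sqrt_of_sq_le h3)

theorem hEmbedsIntoLq (T : ℝ) [hT : Fact (0 < T)] {κ : ℤ} (hκ : Odd κ) {q : ℝ} (hq : 2 ≤ q)
    (hq4 : q < 4) : HEmbedsIntoLq T κ q := by
  refine ⟨fun u hu => ?_, fun u _ v _ U hU hV => ?_, ?_⟩
  · obtain ⟨A, hA, -⟩ := exists_hasSum_hTerm hu
    have h1 : Summable fun k => ‖(u k : L2)‖ ^ 2 :=
      Summable.of_nonneg_of_le (fun _ => sq_nonneg _) (norm_sq_le_hTerm hκ hu.1) hA.summable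
    obtain ⟨x, hx⟩ := summable_mode T h1
    refine ⟨x, (isTimeSeries_iff T).2 ⟨Lp.memLp x, ?_⟩⟩
    rwa [Lp.toLp_coeFn]
  · obtain ⟨_, h1⟩ := (isTimeSeries_iff T).1 hU
    obtain ⟨_, h2⟩ := (isTimeSeries_iff T).1 hV
    have h3 := eq_of_hasSum_mode T h1 h2
    exact funext fun k => Subtype.ext (congrFun h3 k)
  · obtain ⟨C, hC⟩ : ∃ C : ℝ≥0, ∀ u ∈ H κ, ∀ U, IsTimeSeries T u U →
        eLpNorm U (ENNReal.ofReal q) (spaceTimeMeasure T) ≤ C * hNorm κ u := by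
      rcases hq.eq_or_lt with rfl | hq
      · refine ⟨(T ^ (1 / 2 : ℝ)).toNNReal, fun u hu U hU => ?_⟩
        rw [ENNReal.ofReal_ofNat]
        exact eLpNorm_two_le_of_mem_H hκ hu hU
      · exact ⟨(embConst T q ^ (1 / q)).toNNReal, fun u hu U hU =>
          eLpNorm_le_of_mem_H hκ hq hq4 hu hU⟩
    exact ⟨C, fun u hu U hU => ⟨⟨hU.1.1, (hC u hu U hU).trans_lt
      (ENNReal.mul_lt_top ENNReal.coe_lt_top hu.2)⟩, hC u hu U hU⟩⟩

end Necklace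

end

theorem lemmaA2 (T : ℝ) [Fact (0 < T)] (α : ℝ) (hα : 0 ≤ α) (κ : ℤ) (hκ : Odd κ) :
    (Necklace.SpecCondition T α κ →
      ((∃ k₀ : ℕ, Odd k₀ ∧ Necklace.freq T = k₀ / 2) ∨ Necklace.GapCondition T α κ) →
      Necklace.CalHEmbedsIntoH T α κ) ∧
    ∀ q : ℝ, 2 ≤ q → q < 4 → Necklace.HEmbedsIntoLq T κ q :=
  ⟨fun hspec h => Necklace.calHEmbedsIntoH T hα hκ hspec h,
    fun _ hq hq4 => Necklace.hEmbedsIntoLq T hκ hq hq4⟩
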